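/- Let $p\ge 2$ be an integer, and let $\mathbf F:=H^1_0(0,\pi)$ be the space of real functions $f\in L^2(0,\pi)$ whose distributional derivative $f_x$ is in $L^2(0,\pi)$ and whose continuous representative on $[0,\pi]$ vanishes at $0$ and at $\pi$, with the norm $\|f\|^2:=\|f\|_{L^2}^2+\|f_x\|_{L^2}^2$. For $k\ge 1$ put $s_k(x):=\sqrt{2/\pi}\,\sin(kx)$, and for $t\ge 0$, $f\in\mathbf F$, let $\mathcal U(t)f:=\sum_{k=1}^{\infty}e^{-k^2t}\langle s_k|f\rangle_{L^2}\,s_k$ be the Dirichlet heat semigroup on $\mathbf F$. For $f_0\in\mathbf F$ consider the nonlinear heat equation $\dot\varphi=\varphi_{xx}+\varphi^p$, $\varphi(0)=f_0$, in its Volterra (mild) form $$\varphi(t)=\mathcal U(t)f_0+\int_0^t \mathcal U(t-s)\,\varphi(s)^p\,ds ,$$ where a solution is a continuous function $\varphi$ from an interval $[0,t_1]$ ($0<t_1<\infty$) or $[0,t_1)$ ($0<t_1\le\infty$) to $\mathbf F$ satisfying the equation at every point of its domain. Then for every $f_0\in\mathbf F$ there is a maximal solution (one with no proper extension) $\varphi:[0,\vartheta)\to\mathbf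 F$ with $\vartheta\in(0,+\infty]$, every solution is a restriction of it, and $$\vartheta\ge t_N,\qquad \|\varphi(t)\|\le R(t)\quad\text{for all } t\in[0,t_N),$$ where $$t_N:=\begin{cases}+\infty & \text{if }\|f_0\|\le 1,\\[2pt] -\dfrac1{p-1}\log\Big(1-\dfrac1{\|f_0\|^{p-1}}\Big) & \text{if }\|f_0\|>1,\end{cases}\qquad R(t):=\frac{\|f_0\|}{\big[\,1-(\|f_0\|^{p-1}-1)(e^{(p-1)t}-1)\,\big]^{1/(p-1)}},$$ the expression in square brackets being positive for $t\in[0,t_N)$. Moreover: * if $\|f_0\|<1$, then $R$ is nonincreasing on $[0,+\infty)$, strictly decreasing if $f_0\neq0$, and $R(t)\to0$ as $t\to+\infty$; * if $\|f_0\|=1$, then $R(t)=1$ for all $t\ge0$; * if $\|f_0\|>1$, then $R$ is strictly increasing on $[0,t_N)$ and $R(t)\to+\infty$ as $t\to t_N^-$. -/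

import Mathlib

noncomputable section

namespace DirichletHeat

open MeasureTheory Set Filter Topology
open scoped ContDiff

/-- Lebesgue measure on the interval `(0, π)`. -/
abbrev intervalMeasure : Measure ℝ := volume.restrict (Ioo 0 Real.pi)

/-- The real Hilbert space `L²(0, π)`. -/
abbrev L2 : Type := Lp ℝ 2 intervalMeasure

/-- `g` is the distributional derivative of `f` on `(0, π)`. -/
def HasWeakDeriv (f g : ℝ → ℝ) : Prop :=
  ∀ ψ : ℝ → ℝ, ContDiff ℝ ∞ ψ → HasCompactSupport ψ → tsupport ψ ⊆ Ioo 0 Real.pi →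
    ∫ x, f x * deriv ψ x ∂intervalMeasure = - ∫ x, g x * ψ x ∂intervalMeasure

lemma integral_intervalMeasure (f : ℝ → ℝ) :
    ∫ x, f x ∂intervalMeasure = ∫ x in (0 : ℝ)..Real.pi, f x := by
  rw [intervalIntegral.integral_of_le Real.pi_pos.le, integral_Ioc_eq_integral_Ioo]

lemma intervalIntegrable_iff_intervalMeasure (f : ℝ → ℝ) :
    IntervalIntegrable f volume 0 Real.pi ↔ Integrable f intervalMeasure := by
  rw [intervalIntegrable_iff_integrableOn_Ioo_of_le Real.pi_pos.le, IntegrableOn]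

lemma L2_integrable (f : L2) : Integrable (f : ℝ → ℝ) intervalMeasure :=
  (Lp.memLp f).integrable (by norm_num)

lemma integrable_mul_cont {f h : ℝ → ℝ} (hf : Integrable f intervalMeasure)
    (hh : ContinuousOn h (Icc 0 Real.pi)) :
    Integrable (fun x => f x * h x) intervalMeasure := by
  rw [← intervalIntegrable_iff_intervalMeasure] at hf ⊢
  apply hf.mul_continuousOn
  rwa [uIcc_of_le Real.pi_pos.le]

lemma hasWeakDeriv_add {f g f' g' : ℝ → ℝ} (hf : Integrable f intervalMeasure)
    (hf' : Integrable f' intervalMeasure) (hg : Integrable g intervalMeasure)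
    (hg' : Integrable g' intervalMeasure) (h : HasWeakDeriv f f') (k : HasWeakDeriv g g') :
    HasWeakDeriv (f + g) (f' + g') := by
  intro ψ h1 h2 h3
  have c1 : ContinuousOn ψ (Icc 0 Real.pi) := h1.continuous.continuousOn
  have c2 : ContinuousOn (deriv ψ) (Icc 0 Real.pi) :=
    (h1.continuous_deriv (by simp)).continuousOn
  simp only [Pi.add_apply, add_mul]
  rw [integral_add (integrable_mul_cont hf c2) (integrable_mul_cont hg c2),
    integral_add (integrable_mul_cont hf' c1) (integrable_mul_cont hg' c1),
    h ψ h1 h2 h3, k ψ h1 h2 h3]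
  ring

lemma hasWeakDeriv_smul {f f' : ℝ → ℝ} (c : ℝ) (h : HasWeakDeriv f f') :
    HasWeakDeriv (c • f) (c • f') := by
  intro ψ h1 h2 h3
  simp only [Pi.smul_apply, smul_eq_mul, mul_assoc]
  rw [integral_const_mul, integral_const_mul, h ψ h1 h2 h3]
  ring

lemma hasWeakDeriv_congr {f g f' g' : ℝ → ℝ} (hf : f =ᵐ[intervalMeasure] g)
    (hf' : f' =ᵐ[intervalMeasure] g') (h : HasWeakDeriv f f') : HasWeakDeriv g g' := by
  intro ψ h1 h2 h3
  have e1 : (fun x => g x * deriv ψ x) =ᵐ[intervalMeasure] fun x => f x * deriv ψ x :=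
    hf.mono fun x hx => by simp only [hx]
  have e2 : (fun x => g' x * ψ x) =ᵐ[intervalMeasure] fun x => f' x * ψ x :=
    hf'.mono fun x hx => by simp only [hx]
  rw [integral_congr_ae e1, integral_congr_ae e2, h ψ h1 h2 h3]

/-- The Sobolev space `H¹(0, π)`: an element is stored as the pair `(f, f_x)` of `L²` functions,
so that the inner product inherited from `L² × L²` is `⟨f|g⟩_{L²} + ⟨f_x|g_x⟩_{L²}`. -/
def H1 : Submodule ℝ (WithLp 2 (L2 × L2)) where
  carrier := {u | HasWeakDeriv u.fst u.snd}
  zero_mem' := by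
    have h0 : HasWeakDeriv 0 0 := fun ψ _ _ _ => by simp
    exact hasWeakDeriv_congr (Lp.coeFn_zero ℝ 2 intervalMeasure).symm
      (Lp.coeFn_zero ℝ 2 intervalMeasure).symm h0
  add_mem' := by
    intro u v hu hv
    exact hasWeakDeriv_congr (Lp.coeFn_add u.fst v.fst).symm (Lp.coeFn_add u.snd v.snd).symm
      (hasWeakDeriv_add (L2_integrable _) (L2_integrable _) (L2_integrable _)
        (L2_integrable _) hu hv)
  smul_mem' := by
    intro c u hu
    exact hasWeakDeriv_congr (Lp.coeFn_smul c u.fst).symm (Lp.coeFn_smul c u.snd).symm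
      (hasWeakDeriv_smul c hu)

/-- The continuous representative of `f` on `[0, π]` vanishes at both end points. -/
def HasZeroTrace (f : ℝ → ℝ) : Prop :=
  ∃ c : ℝ → ℝ, ContinuousOn c (Icc 0 Real.pi) ∧ f =ᵐ[intervalMeasure] c ∧
    c 0 = 0 ∧ c Real.pi = 0

/-- The space `H¹₀(0, π)` as a subspace of `H¹(0, π)`. -/
def H10Submodule : Submodule ℝ (WithLp 2 (L2 × L2)) where
  carrier := {u | u ∈ H1 ∧ HasZeroTrace u.fst}
  zero_mem' := ⟨H1.zero_mem, 0, continuousOn_const, Lp.coeFn_zero ℝ 2 intervalMeasure, rfl, rfl⟩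
  add_mem' := by
    rintro u v ⟨hu, c, hc, huc, c0, cp⟩ ⟨hv, d, hd, hvd, d0, dp⟩
    refine ⟨H1.add_mem hu hv, c + d, hc.add hd, ?_, by simp [c0, d0], by simp [cp, dp]⟩
    exact (Lp.coeFn_add u.fst v.fst).trans (huc.add hvd)
  smul_mem' := by
    rintro a u ⟨hu, c, hc, huc, c0, cp⟩
    refine ⟨H1.smul_mem a hu, a • c, hc.const_smul a, ?_, by simp [c0], by simp [cp]⟩
    exact (Lp.coeFn_smul a u.fst).trans (huc.const_smul a)

/-- The Hilbert space `H¹₀(0, π)` with `‖f‖² = ‖f‖²_{L²} + ‖f_x‖²_{L²}`. -/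
abbrev H10 : Type := H10Submodule

/-- The function underlying an element of `H¹₀(0, π)`, as an element of `L²(0, π)`. -/
def H10.fn (f : H10) : L2 := (f : WithLp 2 (L2 × L2)).fst

/-- An absolutely continuous function has its pointwise derivative as weak derivative. -/
lemma hasWeakDeriv_of_ac {F f g : ℝ → ℝ} (hF : AbsolutelyContinuousOnInterval F 0 Real.pi)
    (hf : f =ᵐ[intervalMeasure] F) (hg : ∀ᵐ x ∂intervalMeasure, deriv F x = g x)
    {ψ : ℝ → ℝ} (hψ : ContDiff ℝ ∞ ψ) :
    ∫ x, f x * deriv ψ x ∂intervalMeasure =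
      F Real.pi * ψ Real.pi - F 0 * ψ 0 - ∫ x, g x * ψ x ∂intervalMeasure := by
  have hψ' : AbsolutelyContinuousOnInterval ψ 0 Real.pi :=
    (hψ.of_le (by norm_cast)).contDiffOn.absolutelyContinuousOnInterval
  have e1 : (fun x => f x * deriv ψ x) =ᵐ[intervalMeasure] fun x => F x * deriv ψ x :=
    hf.mono fun x hx => by simp only [hx]
  rw [integral_congr_ae e1, integral_intervalMeasure, hF.integral_mul_deriv_eq_deriv_mul hψ',
    ← integral_intervalMeasure]
  have e2 : (fun x => deriv F x * ψ x) =ᵐ[intervalMeasure] fun x => g x * ψ x :=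
    hg.mono fun x hx => by simp only [hx]
  rw [integral_congr_ae e2]

lemma primitive_ac {g : ℝ → ℝ} (hg : Integrable g intervalMeasure) (c : ℝ) :
    AbsolutelyContinuousOnInterval (fun x => c + ∫ t in (0 : ℝ)..x, g t) 0 Real.pi := by
  have h1 : AbsolutelyContinuousOnInterval (fun _ : ℝ => c) 0 Real.pi :=
    (contDiff_const (𝕜 := ℝ) (n := 1)).contDiffOn.absolutelyContinuousOnInterval
  exact h1.add (((intervalIntegrable_iff_intervalMeasure g).2
    hg).absolutelyContinuousOnInterval_intervalIntegral (by simp))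

lemma primitive_hasDerivAt {g : ℝ → ℝ} (hg : Integrable g intervalMeasure) (c : ℝ) :
    ∀ᵐ x ∂intervalMeasure, HasDerivAt (fun x => c + ∫ t in (0 : ℝ)..x, g t) (g x) x := by
  have h := ((intervalIntegrable_iff_intervalMeasure g).2 hg).ae_hasDerivAt_integral
  rw [ae_restrict_iff' measurableSet_Ioo]
  filter_upwards [h] with x hx hx'
  rw [uIcc_of_le Real.pi_pos.le] at hx
  exact (hx (Ioo_subset_Icc_self hx') 0 ⟨le_rfl, Real.pi_pos.le⟩).const_add c

/-- A smooth function supported in `(0, π)` with zero mean is the derivative of another one. -/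
lemma exists_test_primitive {θ : ℝ → ℝ} (h1 : ContDiff ℝ ∞ θ) (h2 : HasCompactSupport θ)
    (h3 : tsupport θ ⊆ Ioo 0 Real.pi) (h4 : ∫ x in (0 : ℝ)..Real.pi, θ x = 0) :
    ∃ ψ : ℝ → ℝ, ContDiff ℝ ∞ ψ ∧ HasCompactSupport ψ ∧ tsupport ψ ⊆ Ioo 0 Real.pi ∧
      deriv ψ = θ := by
  have hd : ∀ x, HasDerivAt (fun x => ∫ t in (0 : ℝ)..x, θ t) (θ x) x := fun x =>
    intervalIntegral.integral_hasDerivAt_right (h1.continuous.intervalIntegrable _ _)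
      (h1.continuous.stronglyMeasurableAtFilter _ _) h1.continuous.continuousAt
  have hd' : deriv (fun x => ∫ t in (0 : ℝ)..x, θ t) = θ := funext fun x => (hd x).deriv
  obtain ⟨a, b, ha, hb, hab⟩ : ∃ a b : ℝ, 0 < a ∧ b < Real.pi ∧ tsupport θ ⊆ Icc a b := by
    rcases (tsupport θ).eq_empty_or_nonempty with he | hne
    · exact ⟨1, 1, by norm_num, by linarith [Real.pi_gt_three], by simp [he]⟩
    · have hc : IsCompact (tsupport θ) := h2
      exact ⟨sInf (tsupport θ), sSup (tsupport θ), (h3 (hc.sInf_mem hne)).1,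
        (h3 (hc.sSup_mem hne)).2, fun x hx =>
          ⟨csInf_le hc.bddBelow hx, le_csSup hc.bddAbove hx⟩⟩
  have hz : ∀ x, x ∉ Icc a b → θ x = 0 := fun x hx =>
    image_eq_zero_of_notMem_tsupport fun h => hx (hab h)
  have hsupp : Function.support (fun x => ∫ t in (0 : ℝ)..x, θ t) ⊆ Icc a b := by
    intro x hx
    by_contra hxn
    apply hx
    rcases lt_or_ge x a with hxa | hxa
    · apply intervalIntegral.integral_zero_ae
      refine Eventually.of_forall fun t ht => hz t fun h => ?_
      rcases mem_uIoc.1 ht with h' | h' <;> linarith [h.1, h'.2]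
    · have hxb : b < x := by
        by_contra hh
        exact hxn ⟨hxa, not_lt.1 hh⟩
      have e : (∫ t in (0 : ℝ)..x, θ t) = (∫ t in (0 : ℝ)..Real.pi, θ t) +
          ∫ t in Real.pi..x, θ t :=
        (intervalIntegral.integral_add_adjacent_intervals
          (h1.continuous.intervalIntegrable _ _) (h1.continuous.intervalIntegrable _ _)).symm
      change (∫ t in (0 : ℝ)..x, θ t) = 0
      rw [e, h4, zero_add]
      apply intervalIntegral.integral_zero_ae
      refine Eventually.of_forall fun t ht => hz t fun h => ?_
      rcases mem_uIoc.1 ht with h' | h' <;> linarith [h.2, h'.1]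
  refine ⟨_, ?_, ?_, ?_, hd'⟩
  · refine contDiff_infty_iff_deriv.2 ⟨fun x => (hd x).differentiableAt, ?_⟩
    rw [hd']; exact h1
  · exact HasCompactSupport.intro isCompact_Icc fun x hx => by
      by_contra h
      exact hx (hsupp h)
  · exact (closure_minimal hsupp isClosed_Icc).trans fun x hx =>
      ⟨ha.trans_le hx.1, hx.2.trans_lt hb⟩

/-- A function with an integrable weak derivative `g` is a.e. a constant plus a primitive
of `g`. -/
lemma exists_ac_rep {f g : ℝ → ℝ} (hf : Integrable f intervalMeasure)
    (hg : Integrable g intervalMeasure) (h : HasWeakDeriv f g) :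
    ∃ c : ℝ, f =ᵐ[intervalMeasure] fun x => c + ∫ t in (0 : ℝ)..x, g t := by
  set G : ℝ → ℝ := fun x => 0 + ∫ t in (0 : ℝ)..x, g t with hG
  have hGac : AbsolutelyContinuousOnInterval G 0 Real.pi := primitive_ac hg 0
  have hGd := primitive_hasDerivAt hg 0
  have hGi : Integrable G intervalMeasure := by
    rw [← intervalIntegrable_iff_intervalMeasure]
    exact hGac.continuousOn.intervalIntegrable
  have hki : Integrable (fun x => f x - G x) intervalMeasure := hf.sub hGi
  have key : ∀ ψ : ℝ → ℝ, ContDiff ℝ ∞ ψ → HasCompactSupport ψ → tsupport ψ ⊆ Ioo 0 Real.pi →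
      ∫ x, (f x - G x) * deriv ψ x ∂intervalMeasure = 0 := by
    intro ψ h1 h2 h3
    have c2 : ContinuousOn (deriv ψ) (Icc 0 Real.pi) :=
      (h1.continuous_deriv (by simp)).continuousOn
    have z0 : ψ 0 = 0 := image_eq_zero_of_notMem_tsupport fun hh => lt_irrefl _ (h3 hh).1
    have z1 : ψ Real.pi = 0 := image_eq_zero_of_notMem_tsupport fun hh => lt_irrefl _ (h3 hh).2
    simp only [sub_mul]
    rw [integral_sub (integrable_mul_cont hf c2) (integrable_mul_cont hGi c2), h ψ h1 h2 h3,
      hasWeakDeriv_of_ac hGac EventuallyEq.rfl (hGd.mono fun x hx => hx.deriv) h1, z0, z1]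
    ring
  obtain ⟨χ, hχt, hχc, hχs, hχr, hχ1⟩ := exists_contDiff_tsupport_subset (n := ⊤)
    (isOpen_Ioo.mem_nhds (⟨by positivity, by linarith [Real.pi_pos]⟩ :
      Real.pi / 2 ∈ Ioo 0 Real.pi))
  set I : ℝ := ∫ x in (0 : ℝ)..Real.pi, χ x with hI
  have hI0 : 0 < I := by
    refine intervalIntegral.integral_pos Real.pi_pos hχs.continuous.continuousOn
      (fun x _ => (hχr ⟨x, rfl⟩).1)
      ⟨Real.pi / 2, ⟨by positivity, by linarith [Real.pi_pos]⟩, by rw [hχ1]; norm_num⟩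
  refine ⟨(∫ x, (f x - G x) * χ x ∂intervalMeasure) / I, ?_⟩
  set c : ℝ := (∫ x, (f x - G x) * χ x ∂intervalMeasure) / I with hc
  have hci : Integrable (fun x => f x - G x - c) intervalMeasure := hki.sub (integrable_const c)
  have hz : ∀ᵐ x : ℝ, x ∈ Ioo 0 Real.pi → f x - G x - c = 0 := by
    refine isOpen_Ioo.ae_eq_zero_of_integral_contDiff_smul_eq_zero
      (IntegrableOn.locallyIntegrableOn hci) fun θ h1 h2 h3 => ?_
    have hr : ∫ x, θ x • (f x - G x - c) = ∫ x, (f x - G x - c) * θ x ∂intervalMeasure := by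
      rw [setIntegral_eq_integral_of_forall_compl_eq_zero]
      · simp only [smul_eq_mul, mul_comm]
      · intro x hx
        rw [image_eq_zero_of_notMem_tsupport fun h => hx (h3 h), mul_zero]
    rw [hr]
    set m : ℝ := ∫ x in (0 : ℝ)..Real.pi, θ x with hm
    have hθ0 : ContDiff ℝ ∞ (fun x => θ x - m / I * χ x) := h1.sub (contDiff_const.mul hχs)
    have t1 : HasCompactSupport (fun x => m / I * χ x) := hχc.mul_left
    have t2 : tsupport (fun x => m / I * χ x) ⊆ Ioo 0 Real.pi :=
      (closure_mono (fun x hx => by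
        intro h0
        exact hx (by simp [h0]))).trans hχt
    obtain ⟨ψ, p1, p2, p3, p4⟩ := exists_test_primitive hθ0 (h2.sub t1)
      ((tsupport_sub θ (fun x => m / I * χ x)).trans (union_subset h3 t2)) (by
        rw [intervalIntegral.integral_sub (h1.continuous.intervalIntegrable _ _)
          ((hχs.continuous.intervalIntegrable _ _).const_mul _),
          intervalIntegral.integral_const_mul, ← hI, ← hm]
        field_simp
        ring)
    have hk := key ψ p1 p2 p3
    rw [p4] at hk
    have iθ := integrable_mul_cont hki h1.continuous.continuousOn
    have iχ := integrable_mul_cont hki hχs.continuous.continuousOn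
    have e : ∫ x, (f x - G x) * (θ x - m / I * χ x) ∂intervalMeasure =
        (∫ x, (f x - G x) * θ x ∂intervalMeasure) -
          m / I * ∫ x, (f x - G x) * χ x ∂intervalMeasure := by
      rw [← integral_const_mul, ← integral_sub iθ (iχ.const_mul _)]
      congr 1
      funext x
      ring
    have e' : ∫ x, (f x - G x - c) * θ x ∂intervalMeasure =
        (∫ x, (f x - G x) * θ x ∂intervalMeasure) - c * m := by
      rw [hm, ← integral_intervalMeasure, ← integral_const_mul, ← integral_sub iθ]
      · congr 1
        funext x
        ring
      · exact ((intervalIntegrable_iff_intervalMeasure θ).1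
          (h1.continuous.intervalIntegrable _ _)).const_mul _
    rw [e']
    rw [e] at hk
    rw [hc, ← hk]
    ring
  rw [EventuallyEq, ae_restrict_iff' measurableSet_Ioo]
  filter_upwards [hz] with x hx hx'
  have := hx hx'
  simp only [hG] at this
  linarith

lemma eqOn_of_ae {F c : ℝ → ℝ} (hF : ContinuousOn F (Icc 0 Real.pi))
    (hc : ContinuousOn c (Icc 0 Real.pi)) (h : F =ᵐ[intervalMeasure] c) :
    EqOn F c (Icc 0 Real.pi) := by
  have h' : F =ᵐ[volume.restrict (Icc 0 Real.pi)] c := by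
    rwa [← restrict_Ioo_eq_restrict_Icc]
  exact Measure.eqOn_Icc_of_ae_eq volume Real.pi_pos.ne h' hF hc

/-- An element of `H¹₀(0, π)` is represented by a primitive of its weak derivative that vanishes
at both end points. -/
lemma H10.exists_rep {u : WithLp 2 (L2 × L2)} (hu : u ∈ H10Submodule) :
    u.fst =ᵐ[intervalMeasure] (fun x => 0 + ∫ t in (0 : ℝ)..x, u.snd t) ∧
      ∫ t in (0 : ℝ)..Real.pi, u.snd t = 0 := by
  obtain ⟨hw, k, hk, huk, k0, kp⟩ := hu
  obtain ⟨c, hc⟩ := exists_ac_rep (L2_integrable _) (L2_integrable _) hw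
  have hac := primitive_ac (L2_integrable u.snd) c
  have hco := hac.continuousOn
  rw [uIcc_of_le Real.pi_pos.le] at hco
  have he := eqOn_of_ae hco hk (hc.symm.trans huk)
  have e0 := he (left_mem_Icc.2 Real.pi_pos.le)
  have e1 := he (right_mem_Icc.2 Real.pi_pos.le)
  simp only [intervalIntegral.integral_same, add_zero, k0] at e0
  simp only [kp, e0, zero_add] at e1
  rw [e0] at hc
  exact ⟨hc, e1⟩

/-- Criterion for membership in `H¹₀(0, π)`. -/
lemma mem_H10_of_ac {F g : ℝ → ℝ} (hF : AbsolutelyContinuousOnInterval F 0 Real.pi)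
    (hg : ∀ᵐ x ∂intervalMeasure, deriv F x = g x) (h0 : F 0 = 0) (hp : F Real.pi = 0)
    (mF : MemLp F 2 intervalMeasure) (mg : MemLp g 2 intervalMeasure) :
    WithLp.toLp 2 (mF.toLp F, mg.toLp g) ∈ H10Submodule := by
  refine ⟨?_, F, ?_, mF.coeFn_toLp, h0, hp⟩
  · intro ψ h1 h2 h3
    have := hasWeakDeriv_of_ac (f := mF.toLp F) (g := mg.toLp g) hF mF.coeFn_toLp
      (by filter_upwards [hg, mg.coeFn_toLp] with x hx hx'; rw [hx, hx']) h1
    simpa [h0, hp] using this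
  · have := hF.continuousOn
    rwa [uIcc_of_le Real.pi_pos.le] at this

lemma memLp_of_continuousOn {F : ℝ → ℝ} (hF : ContinuousOn F (Icc 0 Real.pi)) :
    MemLp F 2 intervalMeasure := by
  obtain ⟨C, hC⟩ := isCompact_Icc.exists_bound_of_continuousOn hF
  refine MemLp.of_bound ((hF.mono Ioo_subset_Icc_self).aestronglyMeasurable measurableSet_Ioo) C ?_
  rw [ae_restrict_iff' measurableSet_Ioo]
  exact Eventually.of_forall fun x hx => hC x (Ioo_subset_Icc_self hx)

/-- `H¹₀(0, π)` is closed under taking pointwise powers. -/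
theorem H10.exists_power (p : ℕ) (hp : p ≠ 0) (f : H10) :
    ∃ g : H10, (g.fn : ℝ → ℝ) =ᵐ[intervalMeasure] fun x => f.fn x ^ p := by
  obtain ⟨u, hu⟩ := f
  obtain ⟨h1, h2⟩ := H10.exists_rep hu
  set F : ℝ → ℝ := fun x => 0 + ∫ t in (0 : ℝ)..x, u.snd t with hF
  have hac : AbsolutelyContinuousOnInterval F 0 Real.pi := primitive_ac (L2_integrable _) 0
  have hd := primitive_hasDerivAt (L2_integrable u.snd) 0
  have hpow : ∀ n : ℕ, AbsolutelyContinuousOnInterval (fun x => F x ^ n) 0 Real.pi := by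
    intro n
    induction n with
    | zero =>
      simpa using (contDiff_const (𝕜 := ℝ) (n := 1)
        (c := (1 : ℝ))).contDiffOn.absolutelyContinuousOnInterval
    | succ n ih => simpa only [pow_succ] using ih.fun_mul hac
  have hcont : ∀ n : ℕ, ContinuousOn (fun x => F x ^ n) (Icc 0 Real.pi) := by
    intro n
    have := (hpow n).continuousOn
    rwa [uIcc_of_le Real.pi_pos.le] at this
  have mg : MemLp (fun x => (p * F x ^ (p - 1)) * u.snd x) 2 intervalMeasure := by
    obtain ⟨C, hC⟩ := isCompact_Icc.exists_bound_of_continuousOn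
      ((hcont (p - 1)).const_smul (p : ℝ))
    refine (Lp.memLp u.snd).of_le_mul (c := C) ?_ ?_
    · exact (((hcont (p - 1)).const_smul (p : ℝ)).mono
        Ioo_subset_Icc_self).aestronglyMeasurable measurableSet_Ioo |>.mul
          (Lp.aestronglyMeasurable u.snd)
    · rw [ae_restrict_iff' measurableSet_Ioo]
      refine Eventually.of_forall fun x hx => ?_
      rw [norm_mul]
      exact mul_le_mul_of_nonneg_right (hC x (Ioo_subset_Icc_self hx)) (norm_nonneg _)
  refine ⟨⟨_, mem_H10_of_ac (hpow p) (hd.mono fun x hx => (hx.pow p).deriv) ?_ ?_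
    (memLp_of_continuousOn (hcont p)) mg⟩, ?_⟩
  · simp [hF, hp]
  · simp [hF, h2, hp]
  · refine (MemLp.coeFn_toLp (memLp_of_continuousOn (hcont p))).trans ?_
    filter_upwards [h1] with x hx
    change F x ^ p = u.fst x ^ p
    rw [hx]

/-- The pointwise power `f ↦ f ^ p` on `H¹₀(0, π)`, for `p ≥ 1`. -/
def power (p : ℕ) (f : H10) : H10 :=
  if hp : p ≠ 0 then (H10.exists_power p hp f).choose else 0

theorem power_spec (p : ℕ) (hp : p ≠ 0) (f : H10) :
    ((power p f).fn : ℝ → ℝ) =ᵐ[intervalMeasure] fun x => f.fn x ^ p := by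
  rw [power, dif_pos hp]
  exact (H10.exists_power p hp f).choose_spec

/-- An element of `H¹₀(0, π)` is determined by its underlying function. -/
theorem H10.fn_injective : Function.Injective H10.fn := by
  rintro ⟨u, hu⟩ ⟨v, hv⟩ h
  change u.fst = v.fst at h
  have hd : u - v ∈ H10Submodule := H10Submodule.sub_mem hu hv
  have h1 : (u - v).fst = 0 := by simp [h]
  have h2 := hd.1
  have hz : ∀ᵐ x : ℝ, x ∈ Ioo 0 Real.pi → (u - v).snd x = 0 := by
    refine isOpen_Ioo.ae_eq_zero_of_integral_contDiff_smul_eq_zero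
      (IntegrableOn.locallyIntegrableOn (L2_integrable (u - v).snd)) fun θ k1 k2 k3 => ?_
    have h3 := h2 θ k1 k2 k3
    have e1 : (fun x => (0 : L2) x * deriv θ x) =ᵐ[intervalMeasure] fun _ => (0 : ℝ) :=
      (Lp.coeFn_zero ℝ 2 intervalMeasure).mono fun x hx => by
        simp only [hx, Pi.zero_apply, zero_mul]
    rw [h1, integral_congr_ae e1] at h3
    rw [← setIntegral_eq_integral_of_forall_compl_eq_zero (s := Ioo 0 Real.pi)]
    · simp only [smul_eq_mul, mul_comm (θ _)]
      simpa using h3.symm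
    · intro x hx
      rw [image_eq_zero_of_notMem_tsupport fun h => hx (k3 h), zero_smul]
  have h4 : (u - v).snd = 0 := by
    apply Lp.ext
    refine EventuallyEq.trans ?_ (Lp.coeFn_zero ℝ 2 intervalMeasure).symm
    exact (ae_restrict_iff' measurableSet_Ioo).2 hz
  have h5 : u.snd = v.snd := sub_eq_zero.1 (by simpa using h4)
  apply Subtype.ext
  apply (WithLp.equiv 2 (L2 × L2)).injective
  exact Prod.ext h h5

lemma mem_H10_iff (u : WithLp 2 (L2 × L2)) : u ∈ H10Submodule ↔
    ∀ ψ : ℝ → ℝ, ContDiff ℝ ∞ ψ → ∫ x, u.fst x * deriv ψ x ∂intervalMeasure +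
      ∫ x, u.snd x * ψ x ∂intervalMeasure = 0 := by
  constructor
  · intro hu ψ hψ
    obtain ⟨h1, h2⟩ := H10.exists_rep hu
    rw [hasWeakDeriv_of_ac (primitive_ac (L2_integrable _) 0) h1
      ((primitive_hasDerivAt (L2_integrable u.snd) 0).mono fun x hx => hx.deriv) hψ, h2]
    simp
  · intro h
    have hw : HasWeakDeriv u.fst u.snd := fun ψ h1 _ _ => eq_neg_of_add_eq_zero_left (h ψ h1)
    obtain ⟨c, hc⟩ := exists_ac_rep (L2_integrable _) (L2_integrable _) hw
    have hac := primitive_ac (L2_integrable u.snd) c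
    have hco := hac.continuousOn
    rw [uIcc_of_le Real.pi_pos.le] at hco
    have hb : ∀ ψ : ℝ → ℝ, ContDiff ℝ ∞ ψ →
        (c + ∫ t in (0 : ℝ)..Real.pi, u.snd t) * ψ Real.pi - c * ψ 0 = 0 := by
      intro ψ hψ
      have := hasWeakDeriv_of_ac hac hc
        ((primitive_hasDerivAt (L2_integrable u.snd) c).mono fun x hx => hx.deriv) hψ
      have h' := h ψ hψ
      simp only [intervalIntegral.integral_same, add_zero] at this
      linarith
    have b1 := hb (fun x => x) contDiff_id
    have b2 := hb (fun _ => 1) contDiff_const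
    simp only [mul_zero, sub_zero, mul_eq_zero, Real.pi_ne_zero, or_false] at b1
    rw [b1] at b2
    refine ⟨hw, _, hco, hc, ?_, b1⟩
    simp only [intervalIntegral.integral_same]
    linarith

/-- `H¹₀(0, π)` is complete, so Bochner integrals in it are the true ones. -/
instance : CompleteSpace H10 := by
  have hcl : IsClosed (H10Submodule : Set (WithLp 2 (L2 × L2))) := by
    have e : (H10Submodule : Set (WithLp 2 (L2 × L2))) =
        ⋂ ψ : {ψ : ℝ → ℝ // ContDiff ℝ ∞ ψ}, {u | ∫ x, u.fst x * deriv ψ.1 x ∂intervalMeasure +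
      ∫ x, u.snd x * ψ.1 x ∂intervalMeasure = 0} := by
      ext u
      simp only [SetLike.mem_coe, mem_H10_iff, mem_iInter, mem_ofPred_eq, Subtype.forall]
    rw [e]
    refine isClosed_iInter fun ψ => ?_
    have m1 : MemLp (deriv ψ.1) 2 intervalMeasure :=
      memLp_of_continuousOn (ψ.2.continuous_deriv (by simp)).continuousOn
    have m2 : MemLp ψ.1 2 intervalMeasure := memLp_of_continuousOn ψ.2.continuous.continuousOn
    have hin : ∀ (w : L2) {k : ℝ → ℝ} (hk : MemLp k 2 intervalMeasure),
        ∫ x, w x * k x ∂intervalMeasure = inner ℝ (hk.toLp k) w := by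
      intro w k hk
      rw [L2.inner_def]
      refine integral_congr_ae ?_
      filter_upwards [hk.coeFn_toLp] with x hx
      simp [hx]
    have : {u : WithLp 2 (L2 × L2) | ∫ x, u.fst x * deriv ψ.1 x ∂intervalMeasure +
        ∫ x, u.snd x * ψ.1 x ∂intervalMeasure = 0} =
        {u | inner ℝ (m1.toLp _) u.fst + inner ℝ (m2.toLp _) u.snd = (0 : ℝ)} := by
      ext u
      simp only [mem_ofPred_eq, hin _ m1, hin _ m2]
    rw [this]
    refine isClosed_eq ?_ continuous_const
    have c1 : Continuous fun u : WithLp 2 (L2 × L2) => u.fst :=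
      continuous_fst.comp (WithLp.prod_continuous_ofLp 2 L2 L2)
    have c2 : Continuous fun u : WithLp 2 (L2 × L2) => u.snd :=
      continuous_snd.comp (WithLp.prod_continuous_ofLp 2 L2 L2)
    exact (continuous_const.inner c1).add (continuous_const.inner c2)
  exact hcl.completeSpace_coe

lemma sine_hasDerivAt (k : ℕ) (x : ℝ) :
    HasDerivAt (fun x : ℝ => √(2 / Real.pi) * Real.sin (k * x))
      (√(2 / Real.pi) * (k * Real.cos (k * x))) x := by
  have := ((hasDerivAt_id x).const_mul (k : ℝ)).sin.const_mul √(2 / Real.pi)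
  simpa [mul_comm] using this

lemma sine_memLp (k : ℕ) :
    MemLp (fun x : ℝ => √(2 / Real.pi) * Real.sin (k * x)) 2 intervalMeasure :=
  memLp_of_continuousOn (by fun_prop)

lemma sine_deriv_memLp (k : ℕ) :
    MemLp (fun x : ℝ => √(2 / Real.pi) * (k * Real.cos (k * x))) 2 intervalMeasure :=
  memLp_of_continuousOn (by fun_prop)

/-- The function `s_k(x) = √(2/π) sin (k x)` as an element of `H¹₀(0, π)`. -/
def sine (k : ℕ) : H10 :=
  ⟨WithLp.toLp 2 ((sine_memLp k).toLp _, (sine_deriv_memLp k).toLp _), by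
    refine mem_H10_of_ac ?_ (Eventually.of_forall fun x => (sine_hasDerivAt k x).deriv) (by simp)
      (by simp [Real.sin_nat_mul_pi]) _ _
    have : ContDiff ℝ 1 fun x : ℝ => √(2 / Real.pi) * Real.sin (k * x) := by fun_prop
    exact this.contDiffOn.absolutelyContinuousOnInterval⟩

/-- The heat semigroup `𝒰(t) f = ∑_{k ≥ 1} e^{-k² t} ⟨s_k|f⟩_{L²} s_k`, the series converging in
`H¹₀(0, π)`. -/
def heatSemigroup (t : ℝ) (f : H10) : H10 :=
  ∑' k : ℕ, (Real.exp (-((k + 1 : ℕ) : ℝ) ^ 2 * t) * inner ℝ (sine (k + 1)).fn f.fn) • sine (k + 1)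

/-- Intervals of the form `[0, t₁]` or `[0, t₁)` with `t₁ > 0`, possibly `t₁ = +∞`. -/
def IsTimeInterval (J : Set ℝ) : Prop :=
  ∃ t₁ : EReal, 0 < t₁ ∧
    (J = {t : ℝ | 0 ≤ t ∧ (t : EReal) < t₁} ∨ J = {t : ℝ | 0 ≤ t ∧ (t : EReal) ≤ t₁})

section Volterra

variable {E : Type*} [NormedAddCommGroup E] [NormedSpace ℝ E]

/-- `φ` is a solution, with domain `J`, of the Volterra problem
`φ(t) = U(t) f₀ + ∫₀ᵗ U(t - s) P(φ(s)) ds`.  Only the values of `φ` on `J` matter. -/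
def IsVolterraSolution (U : ℝ → E → E) (P : E → E) (f₀ : E) (J : Set ℝ) (φ : ℝ → E) : Prop :=
  IsTimeInterval J ∧ ContinuousOn φ J ∧
    ∀ t ∈ J, φ t = U t f₀ + ∫ s in (0 : ℝ)..t, U (t - s) (P (φ s))

/-- `φ` is a maximal solution: it has no proper extension. -/
def IsMaximalVolterraSolution (U : ℝ → E → E) (P : E → E) (f₀ : E) (J : Set ℝ) (φ : ℝ → E) :
    Prop :=
  IsVolterraSolution U P f₀ J φ ∧
    ∀ (J' : Set ℝ) (ψ : ℝ → E), IsVolterraSolution U P f₀ J' ψ → J ⊆ J' → EqOn ψ φ J → J' = J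

end Volterra

/-- The finite time `-(1/(p-1)) log (1 - 1/a^{p-1})`, meaningful for `a > 1`. -/
def finiteNormTime (p : ℕ) (a : ℝ) : ℝ :=
  -(1 / ((p : ℝ) - 1)) * Real.log (1 - 1 / a ^ (p - 1))

open Classical in
/-- The time `t_N` for a datum of norm `a`. -/
def normTime (p : ℕ) (a : ℝ) : EReal :=
  if a ≤ 1 then ⊤ else (finiteNormTime p a : EReal)

/-- The expression `1 - (a^{p-1} - 1)(e^{(p-1)t} - 1)`. -/
def boundBracket (p : ℕ) (a t : ℝ) : ℝ :=
  1 - (a ^ (p - 1) - 1) * (Real.exp (((p : ℝ) - 1) * t) - 1)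

/-- The bound `R(t) = a / [1 - (a^{p-1} - 1)(e^{(p-1)t} - 1)]^{1/(p-1)}` for a datum of
norm `a`. -/
def normBound (p : ℕ) (a t : ℝ) : ℝ :=
  a / boundBracket p a t ^ (1 / ((p : ℝ) - 1))

end DirichletHeat

end

/-!
The nonlinear heat equation is solved in `H¹₀(0, π)` by comparing it with the scalar equation
`R' = -R + Rᵖ`, whose solution with `R(0) = ‖f₀‖` is `normBound p ‖f₀‖`. The comparison rests on two
estimates, both with constant `1`.

* `norm_power_le`: `‖fᵖ‖ ≤ ‖f‖ᵖ`. If `A(x)` is the energy `∫₀ˣ (f² + f_x²)` and `E = ‖f‖²`, then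
  `f² ≤ min(A, E - A)`, because `f` vanishes at both ends and `(f²)_x ≤ f² + f_x²`. Hence
  `‖f²‖² ≤ 4 ∫ f² A' ≤ 4 ∫₀ᴱ min(y, E - y) dy = E²`. Polarization and the parallelogram law turn
  this into `‖f g‖ ≤ ‖f‖ ‖g‖` (`H10.norm_mul_le`), from which the bound for powers and their
  Lipschitz continuity on balls follow by induction.
* `norm_heatSemigroup_le`: `‖𝒰(t) f‖ ≤ e⁻ᵗ ‖f‖`. The functions `s_k` are eigenvectors of
  `1 - d²/dx²`, so, once normalized, they are orthonormal in `H¹₀(0, π)`, and `𝒰(t)` multiplies the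
  `k`-th coefficient by `e^{-k² t} ≤ e⁻ᵗ`. Completeness of this system is not needed.

The rest is abstract (`exists_maximal_volterra`). Truncating the nonlinearity radially at radius `M`
makes it bounded and Lipschitz, so that the truncated problem has a unique solution `Φ M` on
`[0, ∞)`. By Grönwall's lemma every solution of the original problem agrees with `Φ M` as long as it
stays in the ball of radius `M`. Therefore the times up to which some `Φ M` stays in the open ball
form the half-open interval `[0, ϑ)`, on which the functions `Φ M` glue to the maximal solution. No
semigroup law is involved. Comparing `‖Φ M‖` with the scalar solution `R` on `[0, T]`, where `M`
exceeds the maximum of `R`, gives both `T < ϑ` and the bound `‖φ‖ ≤ R`, for each `T < t_N`.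
-/

noncomputable section

namespace DirichletHeat

open MeasureTheory Set Filter Topology
open scoped ContDiff

/-! ### Energy estimates for absolutely continuous functions -/

section Energy

variable {F e : ℝ → ℝ} {a b c : ℝ}

lemma integral_primitive_mul_self (he : IntervalIntegrable e volume a b) (hc : c ∈ uIcc a b) :
    ∫ x in a..b, (∫ t in c..x, e t) * e x =
      ((∫ t in c..b, e t) ^ 2 - (∫ t in c..a, e t) ^ 2) / 2 := by
  have hac := he.absolutelyContinuousOnInterval_intervalIntegral hc
  have hd : ∀ᵐ x, x ∈ uIoc a b → deriv (fun x => ∫ t in c..x, e t) x = e x := by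
    filter_upwards [he.ae_hasDerivAt_integral] with x hx hx'
    exact (hx (uIoc_subset_uIcc hx') c hc).deriv
  have h := hac.integral_mul_deriv_eq_deriv_mul hac
  have h1 : ∫ x in a..b, (∫ t in c..x, e t) * deriv (fun x => ∫ t in c..x, e t) x =
      ∫ x in a..b, (∫ t in c..x, e t) * e x :=
    intervalIntegral.integral_congr_ae (hd.mono fun x hx hx' => by rw [hx hx'])
  have h2 : ∫ x in a..b, deriv (fun x => ∫ t in c..x, e t) x * (∫ t in c..x, e t) =
      ∫ x in a..b, (∫ t in c..x, e t) * e x :=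
    intervalIntegral.integral_congr_ae (hd.mono fun x hx hx' => by rw [hx hx', mul_comm])
  rw [h1, h2] at h
  linarith

lemma abs_sq_sub_sq_le_integral_energy (hF : AbsolutelyContinuousOnInterval F a b) (hab : a ≤ b)
    (he : IntervalIntegrable (fun x => F x ^ 2 + deriv F x ^ 2) volume a b) :
    |F b ^ 2 - F a ^ 2| ≤ ∫ x in a..b, (F x ^ 2 + deriv F x ^ 2) := by
  have h := hF.integral_mul_deriv_eq_deriv_mul hF
  have h2 : F b ^ 2 - F a ^ 2 = ∫ x in a..b, 2 * (F x * deriv F x) := by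
    rw [intervalIntegral.integral_const_mul]
    simp only [mul_comm (deriv F _)] at h
    linarith
  have hi : IntervalIntegrable (fun x => 2 * (F x * deriv F x)) volume a b :=
    (hF.intervalIntegrable_deriv.continuousOn_mul hF.continuousOn).const_mul 2
  rw [h2]
  refine (intervalIntegral.abs_integral_le_integral_abs hab).trans
    (intervalIntegral.integral_mono_on hab hi.abs he fun x _ => ?_)
  rw [abs_le]
  constructor <;> nlinarith [sq_nonneg (F x + deriv F x), sq_nonneg (F x - deriv F x)]

/-- If `F` vanishes at both ends and `E` is the integral of its energy density `F² + F'²`, then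
`F²` is at most the energy on either side of the point, so that, with the energy on the left as
the variable of integration, the integral is at most `∫₀ᴱ min(y, E - y) dy`. -/
lemma integral_sq_mul_energy_le (hF : AbsolutelyContinuousOnInterval F a b) (hab : a ≤ b)
    (ha : F a = 0) (hb : F b = 0)
    (he : IntervalIntegrable (fun x => F x ^ 2 + deriv F x ^ 2) volume a b) :
    ∫ x in a..b, F x ^ 2 * (F x ^ 2 + deriv F x ^ 2) ≤
      (∫ x in a..b, (F x ^ 2 + deriv F x ^ 2)) ^ 2 / 4 := by
  set e : ℝ → ℝ := fun x => F x ^ 2 + deriv F x ^ 2 with hedef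
  have e0 : ∀ x, 0 ≤ e x := fun x => by positivity
  have hu : uIcc a b = Icc a b := uIcc_of_le hab
  have sub : ∀ {x y}, x ∈ Icc a b → y ∈ Icc a b → uIcc x y ⊆ uIcc a b := fun hx hy =>
    uIcc_subset_uIcc (hu ▸ hx) (hu ▸ hy)
  have hei : ∀ {x y}, x ∈ Icc a b → y ∈ Icc a b → IntervalIntegrable e volume x y :=
    fun hx hy => he.mono_set (sub hx hy)
  have hcF : ContinuousOn (fun x => F x ^ 2) (uIcc a b) := hF.continuousOn.pow 2
  have hA : AbsolutelyContinuousOnInterval (fun x => ∫ t in a..x, e t) a b :=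
    he.absolutelyContinuousOnInterval_intervalIntegral left_mem_uIcc
  have hcA : ContinuousOn (fun x => ∫ t in a..x, e t) (uIcc a b) := hA.continuousOn
  have hB : AbsolutelyContinuousOnInterval (fun x => ∫ t in b..x, e t) a b :=
    he.absolutelyContinuousOnInterval_intervalIntegral right_mem_uIcc
  have hcB : ContinuousOn (fun x => ∫ t in b..x, e t) (uIcc a b) := hB.continuousOn
  have la := left_mem_Icc.2 hab
  have lb := right_mem_Icc.2 hab
  -- the point that halves the energy
  obtain ⟨m, hm, hmE⟩ : ∃ m ∈ Icc a b, ∫ t in a..m, e t = (∫ t in a..b, e t) / 2 := by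
    have hpos : 0 ≤ ∫ t in a..b, e t := intervalIntegral.integral_nonneg hab fun x _ => e0 x
    have := intermediate_value_Icc hab (hu ▸ hcA)
    refine this ⟨?_, ?_⟩
    · rw [intervalIntegral.integral_same]; linarith
    · linarith
  have hmE' : ∫ t in m..b, e t = (∫ t in a..b, e t) / 2 := by
    have := intervalIntegral.integral_add_adjacent_intervals (hei la hm) (hei hm lb)
    linarith
  have left : ∫ x in a..m, F x ^ 2 * e x ≤ ∫ x in a..m, (∫ t in a..x, e t) * e x := by
    refine intervalIntegral.integral_mono_on hm.1
      ((hei la hm).continuousOn_mul (hcF.mono (sub la hm)))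
      ((hei la hm).continuousOn_mul (hcA.mono (sub la hm)))
      fun x hx => mul_le_mul_of_nonneg_right ?_ (e0 x)
    have hx' : x ∈ Icc a b := ⟨hx.1, hx.2.trans hm.2⟩
    have := abs_sq_sub_sq_le_integral_energy (hF.mono (sub la hx')) hx.1 (hei la hx')
    rw [ha] at this
    linarith [le_abs_self (F x ^ 2 - 0 ^ 2)]
  have right : ∫ x in m..b, F x ^ 2 * e x ≤ ∫ x in m..b, -((∫ t in b..x, e t) * e x) := by
    refine intervalIntegral.integral_mono_on hm.2
      ((hei hm lb).continuousOn_mul (hcF.mono (sub hm lb)))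
      ((hei hm lb).continuousOn_mul (hcB.mono (sub hm lb))).neg fun x hx => ?_
    have hx' : x ∈ Icc a b := ⟨hm.1.trans hx.1, hx.2⟩
    have := abs_sq_sub_sq_le_integral_energy (hF.mono (sub hx' lb)) hx.2 (hei hx' lb)
    rw [hb, intervalIntegral.integral_symm] at this
    rw [← neg_mul]
    refine mul_le_mul_of_nonneg_right ?_ (e0 x)
    linarith [neg_abs_le (0 ^ 2 - F x ^ 2)]
  rw [integral_primitive_mul_self (hei la hm) left_mem_uIcc, hmE,
    intervalIntegral.integral_same] at left
  rw [intervalIntegral.integral_neg, integral_primitive_mul_self (hei hm lb) right_mem_uIcc,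
    intervalIntegral.integral_symm m b, hmE', intervalIntegral.integral_same] at right
  have hs := intervalIntegral.integral_add_adjacent_intervals
    ((hei la hm).continuousOn_mul (hcF.mono (sub la hm)))
    ((hei hm lb).continuousOn_mul (hcF.mono (sub hm lb)))
  linarith

end Energy

/-! ### Products and powers in `H¹₀(0, π)` -/

/-- The weak derivative of an element of `H¹₀(0, π)`. -/
def H10.dfn (f : H10) : L2 := (f : WithLp 2 (L2 × L2)).snd

lemma H10.ext_ae {f g : H10} (h : (f.fn : ℝ → ℝ) =ᵐ[intervalMeasure] g.fn) : f = g :=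
  H10.fn_injective (Lp.ext h)

lemma H10.inner_eq (f g : H10) :
    inner ℝ f g = ∫ x, f.fn x * g.fn x ∂intervalMeasure +
      ∫ x, f.dfn x * g.dfn x ∂intervalMeasure := by
  rw [Submodule.coe_inner, WithLp.prod_inner_apply, L2.inner_def, L2.inner_def]
  simp only [RCLike.inner_apply, conj_trivial, mul_comm]
  rfl

lemma integrable_mul_of_L2 (f g : L2) : Integrable (fun x => f x * g x) intervalMeasure :=
  (Lp.memLp f).integrable_mul (Lp.memLp g)

/-- The function vanishing at `0` whose derivative is `f_x`: the absolutely continuous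
representative of `f`. -/
def H10.rep (f : H10) (x : ℝ) : ℝ := 0 + ∫ t in (0 : ℝ)..x, f.dfn t

lemma H10.rep_ae (f : H10) : (f.fn : ℝ → ℝ) =ᵐ[intervalMeasure] f.rep := (H10.exists_rep f.2).1

@[simp] lemma H10.rep_zero (f : H10) : f.rep 0 = 0 := by simp [H10.rep]

@[simp] lemma H10.rep_pi (f : H10) : f.rep Real.pi = 0 := by
  rw [H10.rep, zero_add]; exact (H10.exists_rep f.2).2

lemma H10.rep_ac (f : H10) : AbsolutelyContinuousOnInterval f.rep 0 Real.pi :=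
  primitive_ac (L2_integrable _) 0

lemma H10.rep_continuousOn (f : H10) : ContinuousOn f.rep (Icc 0 Real.pi) := by
  have := f.rep_ac.continuousOn
  rwa [uIcc_of_le Real.pi_pos.le] at this

lemma H10.rep_hasDerivAt (f : H10) : ∀ᵐ x ∂intervalMeasure, HasDerivAt f.rep (f.dfn x) x :=
  primitive_hasDerivAt (L2_integrable f.dfn) 0

lemma memLp_continuousOn_mul {k : ℝ → ℝ} (hk : ContinuousOn k (Icc 0 Real.pi)) (v : L2) :
    MemLp (fun x => k x * v x) 2 intervalMeasure := by
  obtain ⟨C, hC⟩ := isCompact_Icc.exists_bound_of_continuousOn hk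
  refine (Lp.memLp v).of_le_mul (c := C) ?_ ?_
  · exact ((hk.mono Ioo_subset_Icc_self).aestronglyMeasurable measurableSet_Ioo).mul
      (Lp.aestronglyMeasurable v)
  · rw [ae_restrict_iff' measurableSet_Ioo]
    refine Eventually.of_forall fun x hx => ?_
    rw [norm_mul]
    exact mul_le_mul_of_nonneg_right (hC x (Ioo_subset_Icc_self hx)) (norm_nonneg _)

lemma H10.exists_mul (f g : H10) : ∃ h : H10,
    ((h.fn : ℝ → ℝ) =ᵐ[intervalMeasure] fun x => f.fn x * g.fn x) ∧
    ((h.dfn : ℝ → ℝ) =ᵐ[intervalMeasure] fun x => f.dfn x * g.fn x + f.fn x * g.dfn x) := by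
  have m1 : MemLp (fun x => f.rep x * g.rep x) 2 intervalMeasure :=
    memLp_of_continuousOn (f.rep_continuousOn.mul g.rep_continuousOn)
  have m2 : MemLp (fun x => f.dfn x * g.rep x + f.rep x * g.dfn x) 2 intervalMeasure := by
    simp only [mul_comm (f.dfn _)]
    exact (memLp_continuousOn_mul g.rep_continuousOn _).add
      (memLp_continuousOn_mul f.rep_continuousOn _)
  refine ⟨⟨_, mem_H10_of_ac (f.rep_ac.fun_mul g.rep_ac) ?_ (by simp) (by simp) m1 m2⟩, ?_, ?_⟩
  · filter_upwards [f.rep_hasDerivAt, g.rep_hasDerivAt] with x hf hg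
    exact (hf.mul hg).deriv
  · refine m1.coeFn_toLp.trans ?_
    filter_upwards [f.rep_ae, g.rep_ae] with x hf hg
    rw [hf, hg]
  · refine m2.coeFn_toLp.trans ?_
    filter_upwards [f.rep_ae, g.rep_ae] with x hf hg
    rw [hf, hg]

/-- The pointwise product on `H¹₀(0, π)`. -/
def H10.mul (f g : H10) : H10 := (H10.exists_mul f g).choose

lemma H10.fn_mul (f g : H10) :
    ((f.mul g).fn : ℝ → ℝ) =ᵐ[intervalMeasure] fun x => f.fn x * g.fn x :=
  (H10.exists_mul f g).choose_spec.1

lemma H10.dfn_mul (f g : H10) : ((f.mul g).dfn : ℝ → ℝ) =ᵐ[intervalMeasure]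
    fun x => f.dfn x * g.fn x + f.fn x * g.dfn x :=
  (H10.exists_mul f g).choose_spec.2

lemma H10.fn_add (f g : H10) :
    ((f + g).fn : ℝ → ℝ) =ᵐ[intervalMeasure] fun x => f.fn x + g.fn x := Lp.coeFn_add f.fn g.fn

lemma H10.fn_sub (f g : H10) :
    ((f - g).fn : ℝ → ℝ) =ᵐ[intervalMeasure] fun x => f.fn x - g.fn x := Lp.coeFn_sub f.fn g.fn

lemma H10.fn_smul (c : ℝ) (f : H10) :
    ((c • f).fn : ℝ → ℝ) =ᵐ[intervalMeasure] fun x => c * f.fn x := Lp.coeFn_smul c f.fn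

lemma H10.sub_mul (f g h : H10) : (f - g).mul h = f.mul h - g.mul h := by
  apply H10.ext_ae
  filter_upwards [H10.fn_mul (f - g) h, H10.fn_mul f h, H10.fn_mul g h, H10.fn_sub f g,
    H10.fn_sub (f.mul h) (g.mul h)] with x h1 h2 h3 h4 h5
  rw [h1, h5, h4, h2, h3]; ring

lemma H10.mul_sub (f g h : H10) : f.mul (g - h) = f.mul g - f.mul h := by
  apply H10.ext_ae
  filter_upwards [H10.fn_mul f (g - h), H10.fn_mul f g, H10.fn_mul f h, H10.fn_sub g h,
    H10.fn_sub (f.mul g) (f.mul h)] with x h1 h2 h3 h4 h5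
  rw [h1, h5, h4, h2, h3]; ring

lemma H10.smul_mul_smul (c d : ℝ) (f g : H10) : (c • f).mul (d • g) = (c * d) • f.mul g := by
  apply H10.ext_ae
  filter_upwards [H10.fn_mul (c • f) (d • g), H10.fn_mul f g, H10.fn_smul c f, H10.fn_smul d g,
    H10.fn_smul (c * d) (f.mul g)] with x h1 h2 h3 h4 h5
  rw [h1, h5, h4, h2, h3]; ring

lemma H10.mul_polarization (f g : H10) :
    f.mul g = (1 / 4 : ℝ) • ((f + g).mul (f + g) - (f - g).mul (f - g)) := by
  apply H10.ext_ae
  filter_upwards [H10.fn_mul f g, H10.fn_mul (f + g) (f + g), H10.fn_mul (f - g) (f - g),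
    H10.fn_add f g, H10.fn_sub f g, H10.fn_sub ((f + g).mul (f + g)) ((f - g).mul (f - g)),
    H10.fn_smul (1 / 4) ((f + g).mul (f + g) - (f - g).mul (f - g))] with x h1 h2 h3 h4 h5 h6 h7
  rw [h1, h7, h6, h2, h3, h4, h5]; ring

lemma H10.norm_sq_eq_energy (f : H10) :
    IntervalIntegrable (fun x => f.rep x ^ 2 + deriv f.rep x ^ 2) volume 0 Real.pi ∧
      ‖f‖ ^ 2 = ∫ x in (0 : ℝ)..Real.pi, (f.rep x ^ 2 + deriv f.rep x ^ 2) := by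
  have h : (fun x => f.fn x * f.fn x + f.dfn x * f.dfn x) =ᵐ[intervalMeasure]
      fun x => f.rep x ^ 2 + deriv f.rep x ^ 2 := by
    filter_upwards [f.rep_ae, f.rep_hasDerivAt] with x h1 h2
    rw [h1, h2.deriv]; ring
  have i1 := integrable_mul_of_L2 f.fn f.fn
  have i2 := integrable_mul_of_L2 f.dfn f.dfn
  refine ⟨(intervalIntegrable_iff_intervalMeasure _).2 ((i1.add i2).congr h), ?_⟩
  rw [← integral_intervalMeasure, ← integral_congr_ae h, integral_add i1 i2,
    ← real_inner_self_eq_norm_sq, H10.inner_eq]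

lemma H10.norm_mul_self_le (f : H10) : ‖f.mul f‖ ≤ ‖f‖ ^ 2 := by
  obtain ⟨hi, hn⟩ := f.norm_sq_eq_energy
  have key := integral_sq_mul_energy_le f.rep_ac Real.pi_pos.le f.rep_zero f.rep_pi hi
  rw [← hn] at key
  refine le_of_sq_le_sq ?_ (by positivity)
  have hc : ContinuousOn (fun x => f.rep x ^ 2) (uIcc 0 Real.pi) := f.rep_ac.continuousOn.pow 2
  have i1 := integrable_mul_of_L2 (f.mul f).fn (f.mul f).fn
  have i2 := integrable_mul_of_L2 (f.mul f).dfn (f.mul f).dfn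
  have hle : ‖f.mul f‖ ^ 2 ≤
      ∫ x, 4 * (f.rep x ^ 2 * (f.rep x ^ 2 + deriv f.rep x ^ 2)) ∂intervalMeasure := by
    rw [← real_inner_self_eq_norm_sq, H10.inner_eq, ← integral_add i1 i2]
    refine integral_mono_ae (i1.add i2) (((intervalIntegrable_iff_intervalMeasure _).1
      (hi.continuousOn_mul hc)).const_mul 4) ?_
    filter_upwards [H10.fn_mul f f, H10.dfn_mul f f, f.rep_ae, f.rep_hasDerivAt] with x h1 h2 h3 h4
    rw [h1, h2, h3, h4.deriv]
    nlinarith [sq_nonneg (f.rep x ^ 2)]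
  rw [integral_const_mul, integral_intervalMeasure] at hle
  linarith

/-- Polarization together with the parallelogram law extends the bound on squares, with the same
constant `1`, to all products. -/
lemma H10.norm_mul_le (f g : H10) : ‖f.mul g‖ ≤ ‖f‖ * ‖g‖ := by
  have unit : ∀ u v : H10, ‖u‖ = 1 → ‖v‖ = 1 → ‖u.mul v‖ ≤ 1 := by
    intro u v hu hv
    rw [H10.mul_polarization, norm_smul]
    have h1 := norm_sub_le ((u + v).mul (u + v)) ((u - v).mul (u - v))
    have h2 := (u + v).norm_mul_self_le
    have h3 := (u - v).norm_mul_self_le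
    have h4 := parallelogram_law_with_norm ℝ u v
    rw [hu, hv] at h4
    rw [Real.norm_of_nonneg (by norm_num)]
    linarith [sq ‖u + v‖, sq ‖u - v‖]
  have mul_eq_zero_of : ∀ u v : H10, u = 0 ∨ v = 0 → u.mul v = 0 := by
    rintro u v (rfl | rfl)
    · simpa using H10.sub_mul 0 0 v
    · simpa using H10.mul_sub u 0 0
  rcases eq_or_ne f 0 with hf | hf
  · rw [mul_eq_zero_of f g (Or.inl hf)]; simpa using by positivity
  rcases eq_or_ne g 0 with hg | hg
  · rw [mul_eq_zero_of f g (Or.inr hg)]; simpa using by positivity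
  have nf : ‖f‖ ≠ 0 := norm_ne_zero_iff.2 hf
  have ng : ‖g‖ ≠ 0 := norm_ne_zero_iff.2 hg
  have h := unit (‖f‖⁻¹ • f) (‖g‖⁻¹ • g) 
    (by rw [norm_smul, norm_inv, norm_norm, inv_mul_cancel₀ nf])
    (by rw [norm_smul, norm_inv, norm_norm, inv_mul_cancel₀ ng])
  rw [H10.smul_mul_smul, norm_smul, Real.norm_of_nonneg (by positivity), ← mul_inv,
    inv_mul_le_iff₀ (by positivity), mul_one] at h
  exact h

lemma power_one (f : H10) : power 1 f = f := by
  apply H10.ext_ae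
  filter_upwards [power_spec 1 one_ne_zero f] with x hx
  rw [hx, pow_one]

lemma power_succ (p : ℕ) (hp : p ≠ 0) (f : H10) : power (p + 1) f = (power p f).mul f := by
  apply H10.ext_ae
  filter_upwards [power_spec p hp f, power_spec (p + 1) p.succ_ne_zero f,
    H10.fn_mul (power p f) f] with x h1 h2 h3
  rw [h2, h3, h1, pow_succ]

lemma norm_power_le (p : ℕ) (hp : p ≠ 0) (f : H10) : ‖power p f‖ ≤ ‖f‖ ^ p := by
  induction p, Nat.one_le_iff_ne_zero.2 hp using Nat.le_induction with
  | base => rw [power_one, pow_one]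
  | succ n hn ih =>
    have hn' := Nat.one_le_iff_ne_zero.1 hn
    rw [power_succ n hn', pow_succ]
    exact (H10.norm_mul_le _ _).trans (mul_le_mul_of_nonneg_right (ih hn') (norm_nonneg _))

lemma exists_norm_power_sub_le (p : ℕ) (hp : p ≠ 0) {M : ℝ} (hM : 0 ≤ M) :
    ∃ K : ℝ, 0 ≤ K ∧ ∀ f g : H10, ‖f‖ ≤ M → ‖g‖ ≤ M →
      ‖power p f - power p g‖ ≤ K * ‖f - g‖ := by
  induction p, Nat.one_le_iff_ne_zero.2 hp using Nat.le_induction with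
  | base => exact ⟨1, zero_le_one, fun f g _ _ => by simp [power_one]⟩
  | succ n hn ih =>
    have hn' := Nat.one_le_iff_ne_zero.1 hn
    obtain ⟨K, hK, h⟩ := ih hn'
    refine ⟨M ^ n + K * M, by positivity, fun f g hf hg => ?_⟩
    have e : power (n + 1) f - power (n + 1) g =
        (power n f).mul (f - g) + (power n f - power n g).mul g := by
      rw [power_succ n hn', power_succ n hn', H10.mul_sub, H10.sub_mul]; abel
    rw [e, add_mul]
    refine (norm_add_le _ _).trans (add_le_add ?_ ?_)
    · refine (H10.norm_mul_le _ _).trans (mul_le_mul_of_nonneg_right ?_ (norm_nonneg _))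
      exact (norm_power_le n hn' f).trans (by gcongr)
    · refine (H10.norm_mul_le _ _).trans ?_
      calc _ ≤ (K * ‖f - g‖) * M := mul_le_mul (h f g hf hg) hg (norm_nonneg _) (by positivity)
        _ = _ := by ring

/-! ### The heat semigroup in an orthonormal system -/

section Orthonormal

variable {E : Type*} [NormedAddCommGroup E] [InnerProductSpace ℝ E] {e : ℕ → E} {c : ℕ → ℝ}

lemma norm_sq_sum_smul_of_orthonormal (he : Orthonormal ℝ e) (c : ℕ → ℝ) (s : Finset ℕ) :
    ‖∑ k ∈ s, c k • e k‖ ^ 2 = ∑ k ∈ s, c k ^ 2 := by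
  rw [← real_inner_self_eq_norm_sq, he.inner_sum]
  simp [sq]

lemma summable_smul_of_orthonormal [CompleteSpace E] (he : Orthonormal ℝ e)
    (hc : Summable fun k => c k ^ 2) : Summable fun k => c k • e k := by
  have := (he.orthogonalFamily.summable_iff_norm_sq_summable c).2 (by simpa using hc)
  simpa using this

lemma norm_sq_tsum_smul_of_orthonormal [CompleteSpace E] (he : Orthonormal ℝ e)
    (hc : Summable fun k => c k ^ 2) : ‖∑' k, c k • e k‖ ^ 2 = ∑' k, c k ^ 2 := by
  have h1 := (summable_smul_of_orthonormal he hc).hasSum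
  have h2 : Tendsto (fun s => ‖∑ k ∈ s, c k • e k‖ ^ 2) atTop (𝓝 (‖∑' k, c k • e k‖ ^ 2)) :=
    (h1.norm).pow 2
  simp only [norm_sq_sum_smul_of_orthonormal he c] at h2
  exact tendsto_nhds_unique h2 hc.hasSum

end Orthonormal

lemma sine_fn (k : ℕ) : ((sine k).fn : ℝ → ℝ) =ᵐ[intervalMeasure]
    fun x => √(2 / Real.pi) * Real.sin (k * x) := (sine_memLp k).coeFn_toLp

lemma sine_dfn (k : ℕ) : ((sine k).dfn : ℝ → ℝ) =ᵐ[intervalMeasure]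
    fun x => √(2 / Real.pi) * (k * Real.cos (k * x)) := (sine_deriv_memLp k).coeFn_toLp

lemma inner_fn_eq (f g : H10) : inner ℝ f.fn g.fn = ∫ x, f.fn x * g.fn x ∂intervalMeasure := by
  rw [L2.inner_def]
  simp only [RCLike.inner_apply, conj_trivial, mul_comm]

/-- Integration by parts: `s_k` is an eigenvector of `1 - d²/dx²`, whose quadratic form is the
inner product of `H¹₀(0, π)`. -/
lemma inner_sine (k : ℕ) (f : H10) :
    inner ℝ (sine k) f = (1 + (k : ℝ) ^ 2) * inner ℝ (sine k).fn f.fn := by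
  set ψ : ℝ → ℝ := fun x => √(2 / Real.pi) * (k * Real.cos (k * x)) with hψ
  have hd : deriv ψ = fun x => √(2 / Real.pi) * (k * (-(k * Real.sin (k * x)))) := by
    funext x
    simp [hψ, mul_comm]
  have h := (mem_H10_iff f).1 f.2 ψ (by fun_prop)
  rw [H10.inner_eq, inner_fn_eq, add_mul, one_mul, ← integral_const_mul]
  congr 1
  have e1 : ∫ x, (f : WithLp 2 (L2 × L2)).fst x * deriv ψ x ∂intervalMeasure =
      -∫ x, (k : ℝ) ^ 2 * ((sine k).fn x * f.fn x) ∂intervalMeasure := by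
    rw [← integral_neg]
    refine integral_congr_ae ?_
    filter_upwards [sine_fn k] with x hx
    rw [hx, hd]
    change f.fn x * _ = _
    ring
  have e2 : ∫ x, (f : WithLp 2 (L2 × L2)).snd x * ψ x ∂intervalMeasure =
      ∫ x, (sine k).dfn x * f.dfn x ∂intervalMeasure := by
    refine integral_congr_ae ?_
    filter_upwards [sine_dfn k] with x hx
    rw [hx]
    exact mul_comm _ _
  rw [e1, e2] at h
  linarith

lemma inner_sine_sine_of_ne {j k : ℕ} (h : j ≠ k) : inner ℝ (sine j) (sine k) = 0 := by
  have h1 := inner_sine j (sine k)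
  have h2 := inner_sine k (sine j)
  rw [real_inner_comm, real_inner_comm (sine j).fn, h1] at h2
  have h3 : ((j : ℝ) ^ 2 - (k : ℝ) ^ 2) * inner ℝ (sine j).fn (sine k).fn = 0 := by linarith
  rcases mul_eq_zero.1 h3 with h4 | h4
  · have : (j : ℝ) ^ 2 = (k : ℝ) ^ 2 := by linarith
    have := (pow_left_inj₀ (Nat.cast_nonneg j) (Nat.cast_nonneg k) two_ne_zero).1 this
    exact absurd (Nat.cast_injective this) h
  · rw [h1, h4, mul_zero]

lemma norm_sq_sine {k : ℕ} (hk : k ≠ 0) : ‖sine k‖ ^ 2 = 1 + (k : ℝ) ^ 2 := by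
  have h := inner_sine k (sine k)
  have k0 : (k : ℝ) ≠ 0 := Nat.cast_ne_zero.2 hk
  have hI : inner ℝ (sine k).fn (sine k).fn = (1 : ℝ) := by
    rw [H10.inner_eq, inner_fn_eq, add_mul, one_mul, add_left_cancel_iff] at h
    rw [inner_fn_eq]
    have hp : 0 < Real.pi := Real.pi_pos
    have hs : √(2 / Real.pi) * √(2 / Real.pi) = 2 / Real.pi :=
      Real.mul_self_sqrt (by positivity)
    -- `k² ∫ s_k² + ∫ (s_k)'² = k² (2/π) ∫ (sin² + cos²) = 2 k²`
    have e : (k : ℝ) ^ 2 * ∫ x, (sine k).fn x * (sine k).fn x ∂intervalMeasure +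
        ∫ x, (sine k).dfn x * (sine k).dfn x ∂intervalMeasure = 2 * (k : ℝ) ^ 2 := by
      rw [← integral_const_mul, ← integral_add ((integrable_mul_of_L2 _ _).const_mul _)
        (integrable_mul_of_L2 _ _)]
      have : ∫ x, ((k : ℝ) ^ 2 * ((sine k).fn x * (sine k).fn x) +
          (sine k).dfn x * (sine k).dfn x) ∂intervalMeasure =
          ∫ _, 2 / Real.pi * (k : ℝ) ^ 2 ∂intervalMeasure := by
        refine integral_congr_ae ?_
        filter_upwards [sine_fn k, sine_dfn k] with x h1 h2
        rw [h1, h2]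
        linear_combination (√(2 / Real.pi) * √(2 / Real.pi) * (k : ℝ) ^ 2) *
          Real.sin_sq_add_cos_sq (k * x) + (k : ℝ) ^ 2 * hs
      rw [this, integral_intervalMeasure, intervalIntegral.integral_const, smul_eq_mul]
      field_simp
      ring
    rw [h] at e
    have : (k : ℝ) ^ 2 * (∫ x, (sine k).fn x * (sine k).fn x ∂intervalMeasure - 1) = 0 := by
      linarith
    rcases mul_eq_zero.1 this with h' | h'
    · exact absurd h' (by positivity)
    · linarith
  rw [← real_inner_self_eq_norm_sq, h, hI, mul_one]

lemma H10.inner_smul_left (c : ℝ) (f g : H10) : inner ℝ (c • f) g = c * inner ℝ f g :=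
  real_inner_smul_left f g c

lemma H10.inner_smul_right (c : ℝ) (f g : H10) : inner ℝ f (c • g) = c * inner ℝ f g :=
  real_inner_smul_right f g c

/-- The functions `s_k`, `k ≥ 1`, normalized in `H¹₀(0, π)` and indexed from `0`. -/
def unitSine (k : ℕ) : H10 := ‖sine (k + 1)‖⁻¹ • sine (k + 1)

lemma norm_sine_ne_zero (k : ℕ) : ‖sine (k + 1)‖ ≠ 0 := fun h => by
  have := norm_sq_sine k.succ_ne_zero
  rw [h] at this
  nlinarith [sq_nonneg ((k + 1 : ℕ) : ℝ)]

lemma orthonormal_unitSine : Orthonormal ℝ unitSine := by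
  constructor
  · intro k
    rw [unitSine, norm_smul, norm_inv, norm_norm, inv_mul_cancel₀ (norm_sine_ne_zero k)]
  · intro j k hjk
    rw [unitSine, unitSine, H10.inner_smul_left, H10.inner_smul_right,
      inner_sine_sine_of_ne (by simpa using hjk)]
    simp

/-- The `H¹₀`-orthonormal expansion of the heat semigroup. -/
lemma heatSemigroup_eq (t : ℝ) (f : H10) : heatSemigroup t f =
    ∑' k : ℕ, (Real.exp (-((k + 1 : ℕ) : ℝ) ^ 2 * t) * inner ℝ (unitSine k) f) • unitSine k := by
  refine tsum_congr fun k => ?_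
  have h := inner_sine (k + 1) f
  rw [← norm_sq_sine k.succ_ne_zero] at h
  rw [unitSine, H10.inner_smul_left, h, smul_smul]
  congr 1
  have := norm_sine_ne_zero k
  field_simp

lemma sq_heat_coeff_le {t : ℝ} (ht : 0 ≤ t) (f : H10) (k : ℕ) :
    (Real.exp (-((k + 1 : ℕ) : ℝ) ^ 2 * t) * inner ℝ (unitSine k) f) ^ 2 ≤
      Real.exp (-t) ^ 2 * inner ℝ (unitSine k) f ^ 2 := by
  rw [mul_pow]
  have h : Real.exp (-((k + 1 : ℕ) : ℝ) ^ 2 * t) ≤ Real.exp (-t) := by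
    rw [Real.exp_le_exp]
    have : (1 : ℝ) ≤ ((k + 1 : ℕ) : ℝ) ^ 2 := one_le_pow₀ (by simp)
    nlinarith
  gcongr

lemma summable_sq_inner_unitSine (f : H10) :
    Summable fun k => inner ℝ (unitSine k) f ^ 2 := by
  simpa using orthonormal_unitSine.inner_products_summable f

lemma summable_sq_heat_coeff {t : ℝ} (ht : 0 ≤ t) (f : H10) :
    Summable fun k : ℕ =>
      (Real.exp (-((k + 1 : ℕ) : ℝ) ^ 2 * t) * inner ℝ (unitSine k) f) ^ 2 :=
  ((summable_sq_inner_unitSine f).mul_left (Real.exp (-t) ^ 2)).of_nonneg_of_le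
    (fun _ => sq_nonneg _) (sq_heat_coeff_le ht f)

/-- The decay rate is the first Dirichlet eigenvalue `1`. -/
lemma norm_heatSemigroup_le {t : ℝ} (ht : 0 ≤ t) (f : H10) :
    ‖heatSemigroup t f‖ ≤ Real.exp (-t) * ‖f‖ := by
  refine le_of_sq_le_sq ?_ (by positivity)
  rw [heatSemigroup_eq, norm_sq_tsum_smul_of_orthonormal orthonormal_unitSine
    (summable_sq_heat_coeff ht f)]
  refine ((summable_sq_heat_coeff ht f).tsum_le_tsum (sq_heat_coeff_le ht f)
    ((summable_sq_inner_unitSine f).mul_left _)).trans ?_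
  rw [tsum_mul_left, mul_pow]
  gcongr
  simpa using orthonormal_unitSine.tsum_inner_products_le f

lemma heatSemigroup_sub {t : ℝ} (ht : 0 ≤ t) (f g : H10) :
    heatSemigroup t (f - g) = heatSemigroup t f - heatSemigroup t g := by
  simp only [heatSemigroup_eq]
  rw [← (summable_smul_of_orthonormal orthonormal_unitSine (summable_sq_heat_coeff ht f)).tsum_sub
    (summable_smul_of_orthonormal orthonormal_unitSine (summable_sq_heat_coeff ht g))]
  refine tsum_congr fun k => ?_
  rw [inner_sub_right, ← sub_smul, mul_sub]

lemma continuousOn_heatSemigroup (f : H10) : ContinuousOn (fun t => heatSemigroup t f) (Ici 0) := by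
  intro t₀ ht₀
  rw [ContinuousWithinAt, tendsto_iff_norm_sub_tendsto_zero]
  have hsq : Tendsto (fun t => ‖heatSemigroup t f - heatSemigroup t₀ f‖ ^ 2) (𝓝[Ici 0] t₀)
      (𝓝 0) := by
    set a : ℝ → ℕ → ℝ := fun t k =>
      Real.exp (-((k + 1 : ℕ) : ℝ) ^ 2 * t) * inner ℝ (unitSine k) f with ha
    have hb : ∀ t, 0 ≤ t → ∀ k, (a t k - a t₀ k) ^ 2 ≤ inner ℝ (unitSine k) f ^ 2 := by
      intro t ht k
      have hk : ∀ s, 0 ≤ s → Real.exp (-((k + 1 : ℕ) : ℝ) ^ 2 * s) ≤ 1 := fun s hs =>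
        Real.exp_le_one_iff.2 (by nlinarith [sq_nonneg ((k + 1 : ℕ) : ℝ)])
      rw [ha, ← sub_mul, mul_pow]
      refine mul_le_of_le_one_left (sq_nonneg _) ((sq_le_one_iff_abs_le_one _).2 (abs_le.2 ?_))
      constructor <;> linarith [hk t ht, hk t₀ ht₀, Real.exp_pos (-((k + 1 : ℕ) : ℝ) ^ 2 * t),
        Real.exp_pos (-((k + 1 : ℕ) : ℝ) ^ 2 * t₀)]
    have heq : ∀ t, 0 ≤ t → ‖heatSemigroup t f - heatSemigroup t₀ f‖ ^ 2 =
        ∑' k, (a t k - a t₀ k) ^ 2 := by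
      intro t ht
      rw [heatSemigroup_eq, heatSemigroup_eq,
        ← (summable_smul_of_orthonormal orthonormal_unitSine (summable_sq_heat_coeff ht f)).tsum_sub
        (summable_smul_of_orthonormal orthonormal_unitSine (summable_sq_heat_coeff ht₀ f))]
      simp only [← sub_smul]
      exact norm_sq_tsum_smul_of_orthonormal orthonormal_unitSine
        ((summable_sq_inner_unitSine f).of_nonneg_of_le (fun _ => sq_nonneg _) (hb t ht))
    have hlim := tendsto_tsum_of_dominated_convergence (𝓕 := 𝓝[Ici 0] t₀)
      (f := fun t k => (a t k - a t₀ k) ^ 2) (g := fun _ => 0)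
      (summable_sq_inner_unitSine f)
      (fun k => by
        have hc : Continuous fun t => (a t k - a t₀ k) ^ 2 := by fun_prop
        simpa using (hc.tendsto t₀).mono_left nhdsWithin_le_nhds)
      (by
        filter_upwards [self_mem_nhdsWithin] with t ht k
        rw [Real.norm_of_nonneg (sq_nonneg _)]
        exact hb t ht k)
    rw [tsum_zero] at hlim
    refine hlim.congr' ?_
    filter_upwards [self_mem_nhdsWithin] with t ht
    exact (heq t ht).symm
  simpa using hsq.sqrt

/-! ### Volterra equations with a Lipschitz nonlinearity -/

/-- Grönwall's lemma in integral form, for a homogeneous inequality. -/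
lemma nonpos_of_le_mul_integral {u : ℝ → ℝ} {T K : ℝ} (hK : 0 ≤ K)
    (hu : ContinuousOn u (Icc 0 T))
    (h : ∀ t ∈ Icc 0 T, u t ≤ K * ∫ s in (0 : ℝ)..t, u s) : ∀ t ∈ Icc 0 T, u t ≤ 0 := by
  intro t ht
  have hT : 0 ≤ T := ht.1.trans ht.2
  have hint : IntegrableOn u (uIcc 0 T) := by
    rw [uIcc_of_le hT]; exact hu.integrableOn_Icc
  have hd : ∀ x ∈ Ioo 0 T, HasDerivAt (fun x => ∫ s in (0 : ℝ)..x, u s) (u x) x := by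
    intro x hx
    have hx' : x ∈ Icc 0 T := Ioo_subset_Icc_self hx
    refine intervalIntegral.integral_hasDerivAt_right ?_ ?_ (hu.continuousAt (Icc_mem_nhds hx.1 hx.2))
    · exact (hu.mono (Icc_subset_Icc_right hx'.2)).intervalIntegrable_of_Icc hx'.1
    · exact (hu.mono Ioo_subset_Icc_self).stronglyMeasurableAtFilter isOpen_Ioo x hx
  have hd' : ∀ x ∈ Ioo 0 T, HasDerivAt (fun x => Real.exp (-K * x) * ∫ s in (0 : ℝ)..x, u s)
      (Real.exp (-K * x) * (u x - K * ∫ s in (0 : ℝ)..x, u s)) x := by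
    intro x hx
    refine ((((hasDerivAt_id' x).const_mul (-K)).exp).mul (hd x hx)).congr_deriv ?_
    ring
  have hanti : AntitoneOn (fun x => Real.exp (-K * x) * ∫ s in (0 : ℝ)..x, u s) (Icc 0 T) := by
    refine antitoneOn_of_deriv_nonpos (convex_Icc 0 T) ?_ ?_ ?_
    · refine ContinuousOn.mul (by fun_prop) ?_
      have := intervalIntegral.continuousOn_primitive_interval hint
      rwa [uIcc_of_le hT] at this
    · rw [interior_Icc]
      exact fun x hx => (hd' x hx).differentiableAt.differentiableWithinAt
    · rw [interior_Icc]
      intro x hx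
      rw [(hd' x hx).deriv]
      have := h x (Ioo_subset_Icc_self hx)
      exact mul_nonpos_of_nonneg_of_nonpos (Real.exp_pos _).le (by linarith)
  have h0 := hanti (left_mem_Icc.2 hT) ht ht.1
  simp only [intervalIntegral.integral_same, mul_zero] at h0
  have h1 : ∫ s in (0 : ℝ)..t, u s ≤ 0 := nonpos_of_mul_nonpos_right h0 (Real.exp_pos _)
  exact (h t ht).trans (mul_nonpos_of_nonneg_of_nonpos hK h1)

section Abstract

variable {E : Type*} [NormedAddCommGroup E]

/-- A strongly continuous family of additive maps, indexed by the nonnegative times, with decay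
rate `1`. The semigroup law plays no role for Volterra equations. -/
structure IsDecayingFamily (U : ℝ → E → E) : Prop where
  map_sub : ∀ t, 0 ≤ t → ∀ x y, U t (x - y) = U t x - U t y
  norm_le : ∀ t, 0 ≤ t → ∀ x, ‖U t x‖ ≤ Real.exp (-t) * ‖x‖
  continuousOn : ∀ x, ContinuousOn (fun t => U t x) (Ici 0)

namespace IsDecayingFamily

variable {U : ℝ → E → E}

lemma norm_le_norm (hU : IsDecayingFamily U) {t : ℝ} (ht : 0 ≤ t) (x : E) : ‖U t x‖ ≤ ‖x‖ :=
  (hU.norm_le t ht x).trans (mul_le_of_le_one_left (norm_nonneg x) (by simpa using ht))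

lemma continuous_uncurry (hU : IsDecayingFamily U) :
    Continuous fun q : ℝ × E => U (max q.1 0) q.2 := by
  rw [continuous_iff_continuousAt]
  rintro ⟨t₀, x₀⟩
  rw [ContinuousAt, tendsto_iff_norm_sub_tendsto_zero]
  have h1 : Continuous fun q : ℝ × E => U (max q.1 0) x₀ :=
    (hU.continuousOn x₀).comp_continuous (by fun_prop) fun q => mem_Ici.2 (le_max_right _ _)
  have h2 : Tendsto (fun q : ℝ × E => ‖q.2 - x₀‖ + ‖U (max q.1 0) x₀ - U (max t₀ 0) x₀‖)
      (𝓝 (t₀, x₀)) (𝓝 0) := by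
    have h3 : Continuous fun q : ℝ × E => ‖q.2 - x₀‖ + ‖U (max q.1 0) x₀ - U (max t₀ 0) x₀‖ :=
      (continuous_snd.sub continuous_const).norm.add (h1.sub continuous_const).norm
    simpa using h3.tendsto (t₀, x₀)
  refine squeeze_zero (fun _ => norm_nonneg _) (fun q => ?_) h2
  have e : U (max q.1 0) q.2 - U (max t₀ 0) x₀ =
      U (max q.1 0) (q.2 - x₀) + (U (max q.1 0) x₀ - U (max t₀ 0) x₀) := by
    rw [hU.map_sub _ (le_max_right _ _)]; abel
  rw [e]
  exact (norm_add_le _ _).trans (add_le_add_left (hU.norm_le_norm (le_max_right _ _) _) _)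

lemma continuousOn_integrand (hU : IsDecayingFamily U) {g : ℝ → E} {t : ℝ}
    (hg : ContinuousOn g (Icc 0 t)) :
    ContinuousOn (fun s => U (t - s) (g s)) (Icc 0 t) := by
  have h : ContinuousOn (fun s => U (max (t - s) 0) (g s)) (Icc 0 t) :=
    hU.continuous_uncurry.comp_continuousOn ((by fun_prop : ContinuousOn _ _).prodMk hg)
  refine h.congr fun s hs => ?_
  simp only [max_eq_left (sub_nonneg.2 hs.2)]

lemma intervalIntegrable_integrand (hU : IsDecayingFamily U) {g : ℝ → E} {t : ℝ} (ht : 0 ≤ t)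
    (hg : ContinuousOn g (Icc 0 t)) :
    IntervalIntegrable (fun s => U (t - s) (g s)) volume 0 t :=
  (hU.continuousOn_integrand hg).intervalIntegrable_of_Icc ht

variable [NormedSpace ℝ E]

lemma norm_integral_sub_le (hU : IsDecayingFamily U) {g k : ℝ → E} {t : ℝ} (ht : 0 ≤ t)
    (hg : ContinuousOn g (Icc 0 t)) (hk : ContinuousOn k (Icc 0 t)) :
    ‖(∫ s in (0 : ℝ)..t, U (t - s) (g s)) - ∫ s in (0 : ℝ)..t, U (t - s) (k s)‖ ≤
      ∫ s in (0 : ℝ)..t, ‖g s - k s‖ := by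
  rw [← intervalIntegral.integral_sub (hU.intervalIntegrable_integrand ht hg)
    (hU.intervalIntegrable_integrand ht hk)]
  refine intervalIntegral.norm_integral_le_of_norm_le ht (Eventually.of_forall fun s hs => ?_)
    (((hg.sub hk).norm).intervalIntegrable_of_Icc ht)
  have hs' : 0 ≤ t - s := sub_nonneg.2 hs.2
  rw [← hU.map_sub _ hs']
  exact hU.norm_le_norm hs' _

/-- Uniqueness for a globally Lipschitz nonlinearity. -/
lemma eqOn_of_lipschitz (hU : IsDecayingFamily U) {N : E → E} {K : NNReal} (hN : LipschitzWith K N)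
    {f₀ : E} {T : ℝ} {φ ψ : ℝ → E} (hφ : ContinuousOn φ (Icc 0 T)) (hψ : ContinuousOn ψ (Icc 0 T))
    (eφ : ∀ t ∈ Icc 0 T, φ t = U t f₀ + ∫ s in (0 : ℝ)..t, U (t - s) (N (φ s)))
    (eψ : ∀ t ∈ Icc 0 T, ψ t = U t f₀ + ∫ s in (0 : ℝ)..t, U (t - s) (N (ψ s))) :
    EqOn φ ψ (Icc 0 T) := by
  have key := nonpos_of_le_mul_integral (u := fun t => ‖φ t - ψ t‖) (K := K) K.2 (hφ.sub hψ).norm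
    fun t ht => by
      have sub : Icc 0 t ⊆ Icc 0 T := Icc_subset_Icc_right ht.2
      have cφ := hN.continuous.comp_continuousOn (hφ.mono sub)
      have cψ := hN.continuous.comp_continuousOn (hψ.mono sub)
      rw [eφ t ht, eψ t ht, add_sub_add_left_eq_sub]
      refine (hU.norm_integral_sub_le ht.1 cφ cψ).trans ?_
      rw [← intervalIntegral.integral_const_mul]
      refine intervalIntegral.integral_mono_on ht.1
        ((cφ.sub cψ).norm.intervalIntegrable_of_Icc ht.1)
        ((((hφ.sub hψ).mono sub).norm.const_smul (K : ℝ)).intervalIntegrable_of_Icc ht.1)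
        fun s _ => hN.norm_sub_le _ _
  intro t ht
  exact sub_eq_zero.1 (norm_le_zero_iff.1 (key t ht))

/-- Global solvability for a bounded, globally Lipschitz nonlinearity: after multiplication with
a sufficiently decaying exponential, the right-hand side of the equation is a contraction of the
bounded continuous functions. -/
lemma exists_global [CompleteSpace E] (hU : IsDecayingFamily U) {N : E → E} {K : NNReal} {C : ℝ}
    (hN : LipschitzWith K N) (hC : ∀ x, ‖N x‖ ≤ C) (f₀ : E) :
    ∃ φ : ℝ → E, Continuous φ ∧
      ∀ t, 0 ≤ t → φ t = U t f₀ + ∫ s in (0 : ℝ)..t, U (t - s) (N (φ s)) := by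
  have hC0 : 0 ≤ C := (norm_nonneg _).trans (hC 0)
  set l : ℝ := K + 1 with hl
  have hl1 : 1 ≤ l := by rw [hl]; simp
  have hl0 : 0 < l := zero_lt_one.trans_le hl1
  -- The right-hand side, extended to all real times by its value at `0`.
  let V : (ℝ → E) → ℝ → E := fun φ t =>
    U (max t 0) f₀ + ∫ s in (0 : ℝ)..max t 0, U (max (max t 0 - s) 0) (N (φ s))
  have V_cont : ∀ φ : ℝ → E, Continuous φ → Continuous (V φ) := by
    intro φ hφ
    refine Continuous.add
      (hU.continuous_uncurry.comp (by fun_prop : Continuous fun t : ℝ => (t, f₀)))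
      (intervalIntegral.continuous_parametric_intervalIntegral_of_continuous
        (f := fun t s => U (max (max t 0 - s) 0) (N (φ s))) ?_ (by fun_prop))
    have := hN.continuous
    exact hU.continuous_uncurry.comp
      (by fun_prop : Continuous fun q : ℝ × ℝ => (max q.1 0 - q.2, N (φ q.2)))
  have V_eq : ∀ (φ : ℝ → E) (t : ℝ),
      V φ t = U (max t 0) f₀ + ∫ s in (0 : ℝ)..max t 0, U (max t 0 - s) (N (φ s)) := by
    intro φ t
    simp only [V]
    congr 1
    refine intervalIntegral.integral_congr fun s hs => ?_
    rw [uIcc_of_le (le_max_right t 0)] at hs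
    simp only [max_eq_left (sub_nonneg.2 hs.2)]
  have V_bound : ∀ (φ : ℝ → E) (t : ℝ), ‖V φ t‖ ≤ ‖f₀‖ + C * max t 0 := by
    intro φ t
    refine (norm_add_le _ _).trans (add_le_add (hU.norm_le_norm (le_max_right _ _) _) ?_)
    have := intervalIntegral.norm_integral_le_of_norm_le_const (a := 0) (b := max t 0) (C := C)
      (f := fun s => U (max (max t 0 - s) 0) (N (φ s)))
      fun s _ => (hU.norm_le_norm (le_max_right _ _) _).trans (hC _)
    rwa [sub_zero, abs_of_nonneg (le_max_right _ _)] at this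
  let G : BoundedContinuousFunction ℝ E → BoundedContinuousFunction ℝ E := fun z =>
    BoundedContinuousFunction.ofNormedAddCommGroup
      (fun t => Real.exp (-l * max t 0) • V (fun s => Real.exp (l * s) • z s) t)
      (Continuous.smul (by fun_prop) (V_cont _ (by fun_prop))) (‖f₀‖ + C) (by
        intro t
        have hm : 0 ≤ max t 0 := le_max_right t 0
        rw [norm_smul, Real.norm_of_nonneg (Real.exp_pos _).le]
        have h1 : Real.exp (-l * max t 0) ≤ 1 := Real.exp_le_one_iff.2 (by nlinarith)
        have h2 : Real.exp (-l * max t 0) * max t 0 ≤ 1 := by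
          have h3 : max t 0 ≤ Real.exp (l * max t 0) := by
            nlinarith [Real.add_one_le_exp (l * max t 0)]
          calc _ ≤ Real.exp (-l * max t 0) * Real.exp (l * max t 0) := by gcongr
            _ = 1 := by rw [← Real.exp_add]; simp
        calc _ ≤ Real.exp (-l * max t 0) * (‖f₀‖ + C * max t 0) := by gcongr; exact V_bound _ _
          _ = Real.exp (-l * max t 0) * ‖f₀‖ + C * (Real.exp (-l * max t 0) * max t 0) := by ring
          _ ≤ 1 * ‖f₀‖ + C * 1 := by gcongr
          _ = _ := by ring)
  have hG : ContractingWith (K / (K + 1)) G := by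
    refine ⟨(div_lt_one (by positivity)).2 (by simp), LipschitzWith.of_dist_le_mul fun z w => ?_⟩
    rw [BoundedContinuousFunction.dist_le (by positivity)]
    intro t
    have hm : 0 ≤ max t 0 := le_max_right t 0
    have cz : Continuous fun s => N (Real.exp (l * s) • z s) := by
      have := hN.continuous
      fun_prop
    have cw : Continuous fun s => N (Real.exp (l * s) • w s) := by
      have := hN.continuous
      fun_prop
    have hint : ∫ s in (0 : ℝ)..max t 0, K * (Real.exp (l * s) * dist z w) =
        K * dist z w * ((Real.exp (l * max t 0) - 1) / l) := by
      have : ∫ s in (0 : ℝ)..max t 0, Real.exp (l * s) = (Real.exp (l * max t 0) - 1) / l := by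
        rw [intervalIntegral.integral_comp_mul_left (fun x => Real.exp x) hl0.ne', integral_exp]
        simp [div_eq_inv_mul]
      rw [← this, ← intervalIntegral.integral_const_mul]
      congr 1
      funext s
      ring
    have hle : ‖V (fun s => Real.exp (l * s) • z s) t - V (fun s => Real.exp (l * s) • w s) t‖ ≤
        K * dist z w * ((Real.exp (l * max t 0) - 1) / l) := by
      rw [V_eq, V_eq, add_sub_add_left_eq_sub, ← hint]
      refine (hU.norm_integral_sub_le hm cz.continuousOn cw.continuousOn).trans
        (intervalIntegral.integral_mono_on hm ((cz.sub cw).norm.intervalIntegrable _ _)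
          (Continuous.intervalIntegrable (by fun_prop) _ _) fun s _ => ?_)
      refine (hN.norm_sub_le _ _).trans (mul_le_mul_of_nonneg_left ?_ K.2)
      rw [← smul_sub, norm_smul, Real.norm_of_nonneg (Real.exp_pos _).le, ← dist_eq_norm]
      exact mul_le_mul_of_nonneg_left (z.dist_coe_le_dist s) (Real.exp_pos _).le
    change dist (Real.exp (-l * max t 0) • V _ t) (Real.exp (-l * max t 0) • V _ t) ≤ _
    rw [dist_eq_norm, ← smul_sub, norm_smul, Real.norm_of_nonneg (Real.exp_pos _).le]
    have hee : Real.exp (-l * max t 0) * Real.exp (l * max t 0) = 1 := by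
      rw [← Real.exp_add]; simp
    calc _ ≤ Real.exp (-l * max t 0) * (K * dist z w * ((Real.exp (l * max t 0) - 1) / l)) := by
          gcongr
      _ = K * dist z w / l *
          (Real.exp (-l * max t 0) * Real.exp (l * max t 0) - Real.exp (-l * max t 0)) := by ring
      _ ≤ K * dist z w / l * 1 := by
          gcongr
          rw [hee]
          linarith [Real.exp_pos (-l * max t 0)]
      _ = _ := by rw [hl]; push_cast; ring
  set z := ContractingWith.fixedPoint G hG with hz
  have hfix : G z = z := hG.fixedPoint_isFixedPt
  refine ⟨fun s => Real.exp (l * s) • z s, by fun_prop, fun t ht => ?_⟩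
  have h1 : z t = Real.exp (-l * max t 0) • V (fun s => Real.exp (l * s) • z s) t := by
    conv_lhs => rw [← hfix]
    rfl
  have h2 := V_eq (fun s => Real.exp (l * s) • z s) t
  rw [max_eq_left ht] at h1 h2
  rw [h2] at h1
  change Real.exp (l * t) • z t = _
  rw [h1, smul_smul, ← Real.exp_add]
  simp

/-- Comparison with a scalar Volterra equation whose nonlinearity dominates that of `φ` in the
range of the scalar solution `R`. -/
lemma norm_le_of_scalar (hU : IsDecayingFamily U) {N : E → E} {p : ℕ} {M : ℝ} (hM : 0 ≤ M)
    (hN : ∀ x, ‖N x‖ ≤ min ‖x‖ M ^ p) {f₀ : E} {T : ℝ} {φ : ℝ → E} {R : ℝ → ℝ}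
    (hφ : ContinuousOn φ (Icc 0 T))
    (eφ : ∀ t ∈ Icc 0 T, φ t = U t f₀ + ∫ s in (0 : ℝ)..t, U (t - s) (N (φ s)))
    (hR : ContinuousOn R (Icc 0 T)) (hR0 : ∀ t ∈ Icc 0 T, 0 ≤ R t ∧ R t ≤ M)
    (eR : ∀ t ∈ Icc 0 T, R t = Real.exp (-t) * ‖f₀‖ +
      ∫ s in (0 : ℝ)..t, Real.exp (-(t - s)) * R s ^ p) :
    ∀ t ∈ Icc 0 T, ‖φ t‖ ≤ R t := by
  have key := nonpos_of_le_mul_integral (u := fun t => max (‖φ t‖ - R t) 0) (T := T)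
    (K := p * M ^ (p - 1)) ?_ ((hφ.norm.sub hR).sup continuousOn_const) ?_
  · intro t ht
    linarith [(le_max_left _ _).trans (key t ht)]
  · positivity
  · intro t ht
    have sub : Icc 0 t ⊆ Icc 0 T := Icc_subset_Icc_right ht.2
    have c1 : ContinuousOn (fun s => Real.exp (-(t - s)) * min ‖φ s‖ M ^ p) (Icc 0 t) :=
      ContinuousOn.mul (by fun_prop) ((((hφ.mono sub).norm).inf continuousOn_const).pow p)
    have c2 : ContinuousOn (fun s => Real.exp (-(t - s)) * R s ^ p) (Icc 0 t) :=
      ContinuousOn.mul (by fun_prop) ((hR.mono sub).pow p)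
    have c3 : ContinuousOn (fun s => max (‖φ s‖ - R s) 0) (Icc 0 t) :=
      ((hφ.norm.sub hR).sup continuousOn_const).mono sub
    have hφt : ‖φ t‖ ≤ Real.exp (-t) * ‖f₀‖ +
        ∫ s in (0 : ℝ)..t, Real.exp (-(t - s)) * min ‖φ s‖ M ^ p := by
      rw [eφ t ht]
      refine (norm_add_le _ _).trans (add_le_add (hU.norm_le t ht.1 _) ?_)
      refine intervalIntegral.norm_integral_le_of_norm_le ht.1 (Eventually.of_forall fun s hs => ?_)
        (c1.intervalIntegrable_of_Icc ht.1)
      exact (hU.norm_le _ (sub_nonneg.2 hs.2) _).trans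
        (mul_le_mul_of_nonneg_left (hN _) (Real.exp_pos _).le)
    have hdiff : ‖φ t‖ - R t ≤ p * M ^ (p - 1) * ∫ s in (0 : ℝ)..t, max (‖φ s‖ - R s) 0 := by
      have h1 : ‖φ t‖ - R t ≤ ∫ s in (0 : ℝ)..t,
          (Real.exp (-(t - s)) * min ‖φ s‖ M ^ p - Real.exp (-(t - s)) * R s ^ p) := by
        rw [intervalIntegral.integral_sub (c1.intervalIntegrable_of_Icc ht.1)
          (c2.intervalIntegrable_of_Icc ht.1), eR t ht]
        linarith
      refine h1.trans ?_
      rw [← intervalIntegral.integral_const_mul]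
      refine intervalIntegral.integral_mono_on ht.1 ((c1.sub c2).intervalIntegrable_of_Icc ht.1)
        ((c3.const_smul (p * M ^ (p - 1) : ℝ)).intervalIntegrable_of_Icc ht.1) fun s hs => ?_
      have hs' := hR0 s (sub hs)
      have he : Real.exp (-(t - s)) ≤ 1 := Real.exp_le_one_iff.2 (by linarith [hs.2])
      set y := min ‖φ s‖ M with hy
      have hy0 : 0 ≤ y := le_min (norm_nonneg _) hM
      rw [← mul_sub]
      rcases le_or_gt y (R s) with hle | hlt
      · have : y ^ p ≤ R s ^ p := by gcongr
        exact (mul_nonpos_of_nonneg_of_nonpos (Real.exp_pos _).le (by linarith)).trans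
          (by positivity)
      · have hpow := abs_pow_sub_pow_le y (R s) p
        rw [abs_of_pos (sub_pos.2 hlt), abs_of_nonneg hy0, abs_of_nonneg hs'.1,
          max_eq_left hlt.le] at hpow
        have h2 : 0 ≤ y ^ p - R s ^ p := sub_nonneg.2 (pow_le_pow_left₀ hs'.1 hlt.le p)
        have h3 : y ≤ M := min_le_right _ _
        have h4 : y - R s ≤ max (‖φ s‖ - R s) 0 :=
          le_max_of_le_left (sub_le_sub_right (min_le_left _ _) _)
        calc _ ≤ 1 * (y ^ p - R s ^ p) := by gcongr
          _ ≤ (y - R s) * p * y ^ (p - 1) := by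
            rw [one_mul]; exact (le_abs_self _).trans hpow
          _ ≤ max (‖φ s‖ - R s) 0 * p * M ^ (p - 1) := by gcongr
          _ = _ := by ring
    refine max_le hdiff ?_
    have : 0 ≤ ∫ s in (0 : ℝ)..t, max (‖φ s‖ - R s) 0 :=
      intervalIntegral.integral_nonneg ht.1 fun s _ => le_max_right _ _
    positivity

end IsDecayingFamily

end Abstract

/-! ### Truncation and the maximal solution -/

section Truncation

variable {E : Type*} [NormedAddCommGroup E] [NormedSpace ℝ E] {M : ℝ}

/-- The radial retraction onto the closed ball of radius `M > 0`. -/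
def truncate (M : ℝ) (x : E) : E := (M / max M ‖x‖) • x

lemma truncate_of_norm_le (hM : 0 < M) {x : E} (hx : ‖x‖ ≤ M) : truncate M x = x := by
  rw [truncate, max_eq_left hx, div_self hM.ne', one_smul]

lemma norm_truncate (hM : 0 < M) (x : E) : ‖truncate M x‖ = min ‖x‖ M := by
  have h0 : 0 < max M ‖x‖ := lt_max_of_lt_left hM
  rw [truncate, norm_smul, Real.norm_of_nonneg (by positivity)]
  rcases le_total ‖x‖ M with h | h
  · rw [max_eq_left h, min_eq_left h, div_self hM.ne', one_mul]
  · have : ‖x‖ ≠ 0 := (hM.trans_le h).ne'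
    rw [max_eq_right h, min_eq_right h, div_mul_cancel₀ _ this]

lemma norm_truncate_sub_le (hM : 0 < M) (x y : E) :
    ‖truncate M x - truncate M y‖ ≤ 2 * ‖x - y‖ := by
  set a := max M ‖x‖ with ha
  set b := max M ‖y‖ with hb
  have a0 : 0 < a := lt_max_of_lt_left hM
  have b0 : 0 < b := lt_max_of_lt_left hM
  have hMa : M ≤ a := le_max_left _ _
  have hyb : ‖y‖ ≤ b := le_max_right _ _
  have hab : |b - a| ≤ ‖x - y‖ := by
    have h := abs_max_sub_max_le_max M ‖y‖ M ‖x‖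
    rw [sub_self, abs_zero, max_eq_right (abs_nonneg (‖y‖ - ‖x‖))] at h
    rw [norm_sub_rev]
    exact h.trans (abs_norm_sub_norm_le y x)
  have e : truncate M x - truncate M y = (M / a) • (x - y) + (M * (b - a) / (a * b)) • y := by
    rw [truncate, truncate, ← ha, ← hb, smul_sub]
    have : M * (b - a) / (a * b) = M / a - M / b := by field_simp
    rw [this, sub_smul]
    abel
  rw [e, two_mul]
  refine (norm_add_le _ _).trans (add_le_add ?_ ?_)
  · rw [norm_smul, Real.norm_of_nonneg (by positivity)]
    exact mul_le_of_le_one_left (norm_nonneg _) ((div_le_one a0).2 hMa)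
  · rw [norm_smul, Real.norm_eq_abs, abs_div, abs_mul, abs_of_pos hM, abs_of_pos (mul_pos a0 b0)]
    calc M * |b - a| / (a * b) * ‖y‖ ≤ a * ‖x - y‖ / (a * b) * b := by gcongr
      _ = ‖x - y‖ := by field_simp

end Truncation

lemma IsTimeInterval.Icc_subset {J : Set ℝ} (hJ : IsTimeInterval J) {t : ℝ} (ht : t ∈ J) :
    0 ≤ t ∧ Icc 0 t ⊆ J := by
  obtain ⟨t₁, -, rfl | rfl⟩ := hJ
  · exact ⟨ht.1, fun s hs => ⟨hs.1, (EReal.coe_le_coe_iff.2 hs.2).trans_lt ht.2⟩⟩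
  · exact ⟨ht.1, fun s hs => ⟨hs.1, (EReal.coe_le_coe_iff.2 hs.2).trans ht.2⟩⟩

/-- The maximal solution is glued from the global solutions `Φ M` of the problems whose
nonlinearity is truncated at radius `M`: its domain consists of the times up to which some `Φ M`
stays in the open ball of radius `M`. -/
theorem exists_maximal_volterra {E : Type*} [NormedAddCommGroup E] [NormedSpace ℝ E]
    [CompleteSpace E] {U : ℝ → E → E} (hU : IsDecayingFamily U) {P : E → E} {p : ℕ}
    (hP : ∀ x, ‖P x‖ ≤ ‖x‖ ^ p)
    (hPL : ∀ M : ℝ, 0 ≤ M → ∃ K : ℝ, 0 ≤ K ∧ ∀ x y : E, ‖x‖ ≤ M → ‖y‖ ≤ M →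
      ‖P x - P y‖ ≤ K * ‖x - y‖) (f₀ : E) :
    ∃ (ϑ : EReal) (φ : ℝ → E), 0 < ϑ ∧
      IsMaximalVolterraSolution U P f₀ {t : ℝ | 0 ≤ t ∧ (t : EReal) < ϑ} φ ∧
      (∀ (J : Set ℝ) (ψ : ℝ → E), IsVolterraSolution U P f₀ J ψ →
        J ⊆ {t : ℝ | 0 ≤ t ∧ (t : EReal) < ϑ} ∧ EqOn ψ φ J) ∧
      ∀ (T : ℝ) (R : ℝ → ℝ), 0 ≤ T → ContinuousOn R (Icc 0 T) → (∀ t ∈ Icc 0 T, 0 ≤ R t) →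
        (∀ t ∈ Icc 0 T, R t = Real.exp (-t) * ‖f₀‖ +
          ∫ s in (0 : ℝ)..t, Real.exp (-(t - s)) * R s ^ p) →
        (T : EReal) < ϑ ∧ ‖φ T‖ ≤ R T := by
  -- the truncated nonlinearities
  have hNnorm : ∀ M : ℝ, 0 < M → ∀ x : E, ‖P (truncate M x)‖ ≤ min ‖x‖ M ^ p := by
    intro M hM x
    rw [← norm_truncate hM]
    exact hP _
  have hNlip : ∀ M : ℝ, 0 < M → ∃ K : NNReal, LipschitzWith K fun x : E => P (truncate M x) := by
    intro M hM
    obtain ⟨K, hK, h⟩ := hPL M hM.le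
    refine ⟨NNReal.mk (K * 2) (by positivity), LipschitzWith.of_dist_le_mul fun x y => ?_⟩
    rw [dist_eq_norm, dist_eq_norm]
    refine (h _ _ ?_ ?_).trans ?_
    · rw [norm_truncate hM]; exact min_le_right _ _
    · rw [norm_truncate hM]; exact min_le_right _ _
    · rw [NNReal.coe_mk, mul_assoc]
      exact mul_le_mul_of_nonneg_left (norm_truncate_sub_le hM x y) hK
  have hglob : ∀ M : ℝ, ∃ φ : ℝ → E, 0 < M → Continuous φ ∧
      ∀ t, 0 ≤ t → φ t = U t f₀ + ∫ s in (0 : ℝ)..t, U (t - s) (P (truncate M (φ s))) := by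
    intro M
    by_cases hM : 0 < M
    · obtain ⟨K, hK⟩ := hNlip M hM
      obtain ⟨φ, h1, h2⟩ := hU.exists_global hK (C := M ^ p) (fun x => (hNnorm M hM x).trans
        (pow_le_pow_left₀ (le_min (norm_nonneg _) hM.le) (min_le_right _ _) p)) f₀
      exact ⟨φ, fun _ => ⟨h1, h2⟩⟩
    · exact ⟨0, fun h => absurd h hM⟩
  choose Φ hΦ using hglob
  have trunc_integral : ∀ (M : ℝ) (ψ : ℝ → E) (t : ℝ), 0 < M → 0 ≤ t →
      (∀ s ∈ Icc 0 t, ‖ψ s‖ ≤ M) → ∫ s in (0 : ℝ)..t, U (t - s) (P (truncate M (ψ s))) =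
        ∫ s in (0 : ℝ)..t, U (t - s) (P (ψ s)) := by
    intro M ψ t hM ht hb
    refine intervalIntegral.integral_congr fun s hs => ?_
    rw [uIcc_of_le ht] at hs
    simp only [truncate_of_norm_le hM (hb s hs)]
  have key : ∀ (M T : ℝ) (ψ : ℝ → E), 0 < M → ContinuousOn ψ (Icc 0 T) →
      (∀ t ∈ Icc 0 T, ‖ψ t‖ ≤ M) →
      (∀ t ∈ Icc 0 T, ψ t = U t f₀ + ∫ s in (0 : ℝ)..t, U (t - s) (P (ψ s))) →
      EqOn ψ (Φ M) (Icc 0 T) := by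
    intro M T ψ hM hc hb he
    obtain ⟨K, hK⟩ := hNlip M hM
    refine hU.eqOn_of_lipschitz hK (f₀ := f₀) hc (hΦ M hM).1.continuousOn (fun t ht => ?_)
      fun t ht => (hΦ M hM).2 t ht.1
    rw [trunc_integral M ψ t hM ht.1 fun s hs => hb s ⟨hs.1, hs.2.trans ht.2⟩]
    exact he t ht
  let Good : ℝ → ℝ → Prop := fun M T => 0 < M ∧ ∀ s ∈ Icc 0 T, ‖Φ M s‖ < M
  have good_sol : ∀ M T, Good M T → ∀ t ∈ Icc 0 T,
      Φ M t = U t f₀ + ∫ s in (0 : ℝ)..t, U (t - s) (P (Φ M s)) := by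
    intro M T hG t ht
    rw [← trunc_integral M (Φ M) t hG.1 ht.1 fun s hs => (hG.2 s ⟨hs.1, hs.2.trans ht.2⟩).le]
    exact (hΦ M hG.1).2 t ht.1
  have good_mono : ∀ M T T', Good M T → T' ≤ T → Good M T' := fun M T T' hG h =>
    ⟨hG.1, fun s hs => hG.2 s ⟨hs.1, hs.2.trans h⟩⟩
  have good_eq : ∀ M M' T, Good M T → Good M' T → EqOn (Φ M) (Φ M') (Icc 0 T) := by
    intro M M' T hG hG'
    have hm : 0 < max M M' := lt_max_of_lt_left hG.1
    refine (key (max M M') T (Φ M) hm (hΦ M hG.1).1.continuousOn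
      (fun t ht => (hG.2 t ht).le.trans (le_max_left _ _)) (good_sol M T hG)).trans
      (key (max M M') T (Φ M') hm (hΦ M' hG'.1).1.continuousOn
      (fun t ht => (hG'.2 t ht).le.trans (le_max_right _ _)) (good_sol M' T hG')).symm
  set S : Set ℝ := {T | 0 ≤ T ∧ ∃ M, Good M T}
  have hS0 : (0 : ℝ) ∈ S := by
    have hM : 0 < ‖f₀‖ + 1 := by positivity
    refine ⟨le_rfl, ‖f₀‖ + 1, hM, fun s hs => ?_⟩
    have hs0 : s = 0 := le_antisymm hs.2 hs.1
    rw [hs0, (hΦ _ hM).2 0 le_rfl, intervalIntegral.integral_same, add_zero]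
    linarith [hU.norm_le_norm le_rfl f₀]
  have hSopen : ∀ T ∈ S, ∃ T' ∈ S, T < T' := by
    rintro T ⟨hT, M, hG⟩
    have hev : ∀ᶠ s in 𝓝 T, ‖Φ M s‖ < M :=
      (hΦ M hG.1).1.norm.continuousAt.eventually_lt continuousAt_const
        (hG.2 T (right_mem_Icc.2 hT))
    obtain ⟨ε, hε, h⟩ := Metric.eventually_nhds_iff.1 hev
    refine ⟨T + ε / 2, ⟨by positivity, M, hG.1, fun s hs => ?_⟩, by linarith⟩
    rcases le_or_gt s T with hsT | hsT
    · exact hG.2 s ⟨hs.1, hsT⟩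
    · refine h ?_
      rw [Real.dist_eq, abs_of_pos (sub_pos.2 hsT)]
      linarith [hs.2]
  set ϑ : EReal := sSup ((↑) '' S) with hϑ
  have hSϑ : {t : ℝ | 0 ≤ t ∧ (t : EReal) < ϑ} = S := by
    ext t
    constructor
    · rintro ⟨ht, hlt⟩
      obtain ⟨-, ⟨T, ⟨hT, M, hG⟩, rfl⟩, h⟩ := lt_sSup_iff.1 hlt
      exact ⟨ht, M, good_mono M T t hG (EReal.coe_lt_coe_iff.1 h).le⟩
    · intro ht
      obtain ⟨T', hT', hlt⟩ := hSopen t ht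
      exact ⟨ht.1, (EReal.coe_lt_coe_iff.2 hlt).trans_le (le_sSup ⟨T', hT', rfl⟩)⟩
  have hϑ0 : 0 < ϑ := by
    have : (0 : ℝ) ∈ {t : ℝ | 0 ≤ t ∧ (t : EReal) < ϑ} := hSϑ ▸ hS0
    simpa using this.2
  have hex : ∀ T, ∃ M, T ∈ S → Good M T := fun T => by
    by_cases hT : T ∈ S
    · exact ⟨hT.2.choose, fun _ => hT.2.choose_spec⟩
    · exact ⟨0, fun h => absurd h hT⟩
  choose m hm using hex
  set φ : ℝ → E := fun t => Φ (m t) t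
  have φ_eq : ∀ M T, Good M T → EqOn φ (Φ M) (Icc 0 T) := by
    intro M T hG t ht
    have htS : t ∈ S := ⟨ht.1, M, good_mono M T t hG ht.2⟩
    exact good_eq (m t) M t (hm t htS) (good_mono M T t hG ht.2) (right_mem_Icc.2 ht.1)
  have restrict : ∀ (J : Set ℝ) (ψ : ℝ → E), IsVolterraSolution U P f₀ J ψ →
      J ⊆ S ∧ EqOn ψ φ J := by
    rintro J ψ ⟨hJ, hc, he⟩
    have main : ∀ t ∈ J, t ∈ S ∧ ψ t = φ t := by
      intro t ht
      obtain ⟨ht0, sub⟩ := hJ.Icc_subset ht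
      obtain ⟨C, hC⟩ := isCompact_Icc.exists_bound_of_continuousOn (hc.mono sub)
      have hC0 : 0 ≤ C := (norm_nonneg _).trans (hC t (right_mem_Icc.2 ht0))
      have heq := key (C + 1) t ψ (by positivity) (hc.mono sub)
        (fun s hs => (hC s hs).trans (by linarith)) fun s hs => he s (sub hs)
      have hG : Good (C + 1) t := by
        refine ⟨by positivity, fun s hs => ?_⟩
        rw [← heq hs]
        exact (hC s hs).trans_lt (by linarith)
      exact ⟨⟨ht0, _, hG⟩,
        (heq (right_mem_Icc.2 ht0)).trans (φ_eq _ t hG (right_mem_Icc.2 ht0)).symm⟩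
    exact ⟨fun t ht => (main t ht).1, fun t ht => (main t ht).2⟩
  have sol : IsVolterraSolution U P f₀ S φ := by
    refine ⟨⟨ϑ, hϑ0, Or.inl hSϑ.symm⟩, fun t ht => ?_, fun t ht => ?_⟩
    · obtain ⟨T', ⟨hT', M, hG⟩, hlt⟩ := hSopen t ht
      have h1 : ContinuousWithinAt (Φ M) S t := (hΦ M hG.1).1.continuousWithinAt
      refine h1.congr_of_eventuallyEq ?_ (φ_eq M T' hG ⟨ht.1, hlt.le⟩)
      filter_upwards [self_mem_nhdsWithin, mem_nhdsWithin_of_mem_nhds (Iio_mem_nhds hlt)]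
        with s hs hs'
      exact φ_eq M T' hG ⟨hs.1, le_of_lt hs'⟩
    · obtain ⟨ht0, M, hG⟩ := ht
      have heq := φ_eq M t hG
      rw [heq (right_mem_Icc.2 ht0), good_sol M t hG t (right_mem_Icc.2 ht0)]
      congr 1
      refine intervalIntegral.integral_congr fun s hs => ?_
      rw [uIcc_of_le ht0] at hs
      simp only [heq hs]
  refine ⟨ϑ, φ, hϑ0, ?_, ?_, ?_⟩
  · rw [hSϑ]
    exact ⟨sol, fun J' ψ hψ hsub _ => (restrict J' ψ hψ).1.antisymm hsub⟩
  · rw [hSϑ]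
    exact restrict
  · intro T R hT hR hR0 eR
    obtain ⟨C, hC⟩ := isCompact_Icc.exists_bound_of_continuousOn hR
    have hRC : ∀ t ∈ Icc 0 T, R t ≤ C := fun t ht => (le_abs_self _).trans (hC t ht)
    have hC0 : 0 ≤ C := (hR0 0 (left_mem_Icc.2 hT)).trans (hRC 0 (left_mem_Icc.2 hT))
    have hM : 0 < C + 1 := by positivity
    have hle := hU.norm_le_of_scalar hM.le (hNnorm _ hM) (f₀ := f₀) (T := T)
      (hΦ _ hM).1.continuousOn (fun t ht => (hΦ _ hM).2 t ht.1) hR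
      (fun t ht => ⟨hR0 t ht, (hRC t ht).trans (by linarith)⟩) eR
    have hG : Good (C + 1) T := ⟨hM, fun s hs => by linarith [hle s hs, hRC s hs]⟩
    have hTS : T ∈ {t : ℝ | 0 ≤ t ∧ (t : EReal) < ϑ} := hSϑ ▸ ⟨hT, _, hG⟩
    refine ⟨hTS.2, ?_⟩
    rw [φ_eq _ T hG (right_mem_Icc.2 hT)]
    exact hle T (right_mem_Icc.2 hT)

/-! ### The scalar bound -/

section Bound

variable {p : ℕ} {a t : ℝ}

lemma cast_sub_one_pos (hp : 2 ≤ p) : (0 : ℝ) < (p : ℝ) - 1 := by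
  have : (2 : ℝ) ≤ p := by exact_mod_cast hp
  linarith

lemma one_lt_pow_sub_one (hp : 2 ≤ p) (ha : 1 < a) : 1 < a ^ (p - 1) :=
  one_lt_pow₀ ha (by omega)

lemma boundBracket_eq (p : ℕ) (a t : ℝ) : boundBracket p a t =
    a ^ (p - 1) - (a ^ (p - 1) - 1) * Real.exp (((p : ℝ) - 1) * t) := by
  rw [boundBracket]; ring

lemma exp_finiteNormTime (hp : 2 ≤ p) (ha : 1 < a) :
    Real.exp (((p : ℝ) - 1) * finiteNormTime p a) = a ^ (p - 1) / (a ^ (p - 1) - 1) := by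
  have hq := cast_sub_one_pos hp
  have hA := one_lt_pow_sub_one hp ha
  have h1 : 0 < 1 - 1 / a ^ (p - 1) := by
    rw [sub_pos, div_lt_one (by linarith)]; exact hA
  have e : ((p : ℝ) - 1) * finiteNormTime p a = -Real.log (1 - 1 / a ^ (p - 1)) := by
    rw [finiteNormTime]; field_simp
  rw [e, Real.exp_neg, Real.exp_log h1]
  have : a ^ (p - 1) ≠ 0 := by linarith
  have : a ^ (p - 1) - 1 ≠ 0 := by linarith
  field_simp

lemma boundBracket_finiteNormTime (hp : 2 ≤ p) (ha : 1 < a) :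
    boundBracket p a (finiteNormTime p a) = 0 := by
  have hA := one_lt_pow_sub_one hp ha
  have : a ^ (p - 1) - 1 ≠ 0 := by linarith
  rw [boundBracket_eq, exp_finiteNormTime hp ha]
  field_simp
  ring

lemma strictAnti_boundBracket (hp : 2 ≤ p) (ha : 1 < a) : StrictAnti (boundBracket p a) := by
  intro s t hst
  have hq := cast_sub_one_pos hp
  have hA := sub_pos.2 (one_lt_pow_sub_one hp ha)
  rw [boundBracket, boundBracket]
  gcongr

lemma boundBracket_pos_of_lt (hp : 2 ≤ p) (ha : 1 < a) (ht : t < finiteNormTime p a) :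
    0 < boundBracket p a t := by
  rw [← boundBracket_finiteNormTime hp ha]
  exact strictAnti_boundBracket hp ha ht

lemma one_le_boundBracket (hp : 2 ≤ p) (ha0 : 0 ≤ a) (ha : a ≤ 1) (ht : 0 ≤ t) :
    1 ≤ boundBracket p a t := by
  have h1 : a ^ (p - 1) ≤ 1 := pow_le_one₀ ha0 ha
  have h2 : 1 ≤ Real.exp (((p : ℝ) - 1) * t) :=
    Real.one_le_exp (mul_nonneg (cast_sub_one_pos hp).le ht)
  rw [boundBracket]
  nlinarith

lemma boundBracket_pos (hp : 2 ≤ p) (ha0 : 0 ≤ a) (ht : 0 ≤ t) (h : (t : EReal) < normTime p a) :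
    0 < boundBracket p a t := by
  rcases le_or_gt a 1 with ha | ha
  · exact zero_lt_one.trans_le (one_le_boundBracket hp ha0 ha ht)
  · rw [normTime, if_neg (not_le.2 ha), EReal.coe_lt_coe_iff] at h
    exact boundBracket_pos_of_lt hp ha h

lemma hasDerivAt_boundBracket (p : ℕ) (a t : ℝ) : HasDerivAt (boundBracket p a)
    (((p : ℝ) - 1) * (boundBracket p a t - a ^ (p - 1))) t := by
  have h := ((((((hasDerivAt_id' t).const_mul ((p : ℝ) - 1)).exp).sub_const 1).const_mul
    (a ^ (p - 1) - 1)).const_sub 1)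
  refine h.congr_deriv ?_
  rw [boundBracket_eq]
  ring

lemma continuous_boundBracket (p : ℕ) (a : ℝ) : Continuous (boundBracket p a) :=
  continuous_iff_continuousAt.2 fun t => (hasDerivAt_boundBracket p a t).continuousAt

/-- `R` solves `R' = -R + Rᵖ`, written for `eᵗ R(t)`. -/
lemma hasDerivAt_exp_mul_normBound (hp : 2 ≤ p) (h : 0 < boundBracket p a t) :
    HasDerivAt (fun t => Real.exp t * normBound p a t) (Real.exp t * normBound p a t ^ p) t := by
  have hq := cast_sub_one_pos hp
  set q : ℝ := 1 / ((p : ℝ) - 1) with hqd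
  have hqp : q * ((p : ℝ) - 1) = 1 := by rw [hqd]; field_simp
  have hB : 0 < boundBracket p a t ^ q := Real.rpow_pos_of_pos h q
  have h1 := (hasDerivAt_boundBracket p a t).rpow_const (p := q) (Or.inl h.ne')
  have h2 := (Real.hasDerivAt_exp t).fun_mul ((hasDerivAt_const t a).fun_div h1 hB.ne')
  refine h2.congr_deriv ?_
  have e1 : (boundBracket p a t ^ q) ^ p = boundBracket p a t ^ q * boundBracket p a t := by
    rw [← Real.rpow_natCast, ← Real.rpow_mul h.le, ← Real.rpow_add_one h.ne']
    congr 1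
    linarith
  have e2 : a ^ p = a * a ^ (p - 1) := by
    rw [← pow_succ']
    congr 1
    omega
  have e3 : ((p : ℝ) - 1) * (boundBracket p a t - a ^ (p - 1)) * q * boundBracket p a t ^ (q - 1) =
      (boundBracket p a t - a ^ (p - 1)) * (boundBracket p a t ^ q / boundBracket p a t) := by
    rw [Real.rpow_sub_one h.ne']
    linear_combination (boundBracket p a t - a ^ (p - 1)) *
      (boundBracket p a t ^ q / boundBracket p a t) * hqp
  rw [e3, normBound, ← hqd, div_pow, e1, e2]
  field_simp
  ring

@[simp] lemma normBound_zero_right (p : ℕ) (a : ℝ) : normBound p a 0 = a := by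
  simp [normBound, boundBracket]

lemma normBound_nonneg (ha : 0 ≤ a) (h : 0 < boundBracket p a t) : 0 ≤ normBound p a t :=
  div_nonneg ha (Real.rpow_nonneg h.le _)

lemma continuousOn_normBound {s : Set ℝ} (h : ∀ t ∈ s, 0 < boundBracket p a t) :
    ContinuousOn (normBound p a) s := by
  refine continuousOn_const.div ?_ fun t ht => (Real.rpow_pos_of_pos (h t ht) _).ne'
  exact (continuous_boundBracket p a).continuousOn.rpow_const fun t ht => Or.inl (h t ht).ne'

lemma normBound_eq_integral (hp : 2 ≤ p) (ht : 0 ≤ t)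
    (h : ∀ s ∈ Icc 0 t, 0 < boundBracket p a s) :
    normBound p a t = Real.exp (-t) * a +
      ∫ s in (0 : ℝ)..t, Real.exp (-(t - s)) * normBound p a s ^ p := by
  have hc := continuousOn_normBound h
  have hftc := intervalIntegral.integral_eq_sub_of_hasDerivAt
    (f := fun s => Real.exp s * normBound p a s) (a := 0) (b := t)
    (f' := fun s => Real.exp s * normBound p a s ^ p)
    (fun s hs => hasDerivAt_exp_mul_normBound hp (h s (uIcc_of_le ht ▸ hs)))
    (ContinuousOn.intervalIntegrable_of_Icc ht (Real.continuous_exp.continuousOn.mul (hc.pow p)))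
  simp only [Real.exp_zero, normBound_zero_right, one_mul] at hftc
  have e : ∫ s in (0 : ℝ)..t, Real.exp (-(t - s)) * normBound p a s ^ p =
      Real.exp (-t) * ∫ s in (0 : ℝ)..t, Real.exp s * normBound p a s ^ p := by
    rw [← intervalIntegral.integral_const_mul]
    congr 1
    funext s
    rw [← mul_assoc, ← Real.exp_add]
    congr 2
    ring
  rw [e, hftc, mul_sub, ← mul_assoc, ← Real.exp_add]
  simp

lemma normBound_lt_of_boundBracket_lt {s : ℝ} (hp : 2 ≤ p) (ha : 0 < a)
    (hs : 0 < boundBracket p a s) (hst : boundBracket p a s < boundBracket p a t) :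
    normBound p a t < normBound p a s := by
  have hq := one_div_pos.2 (cast_sub_one_pos hp)
  exact div_lt_div_of_pos_left ha (Real.rpow_pos_of_pos hs _)
    (Real.rpow_lt_rpow hs.le hst hq)

lemma strictAntiOn_normBound (hp : 2 ≤ p) (ha0 : 0 < a) (ha : a < 1) :
    StrictAntiOn (normBound p a) (Ici 0) := by
  intro s hs t _ hst
  refine normBound_lt_of_boundBracket_lt hp ha0
    (zero_lt_one.trans_le (one_le_boundBracket hp ha0.le ha.le hs)) ?_
  have hq := cast_sub_one_pos hp
  have hA : 0 < 1 - a ^ (p - 1) := sub_pos.2 (pow_lt_one₀ ha0.le ha (by omega))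
  have he : Real.exp (((p : ℝ) - 1) * s) < Real.exp (((p : ℝ) - 1) * t) := by gcongr
  rw [boundBracket_eq, boundBracket_eq]
  nlinarith

lemma normBound_zero_left (p : ℕ) (t : ℝ) : normBound p 0 t = 0 := by simp [normBound]

lemma antitoneOn_normBound (hp : 2 ≤ p) (ha0 : 0 ≤ a) (ha : a < 1) :
    AntitoneOn (normBound p a) (Ici 0) := by
  rcases ha0.eq_or_lt with rfl | h
  · intro s _ t _ _
    simp [normBound_zero_left]
  · exact (strictAntiOn_normBound hp h ha).antitoneOn

lemma tendsto_normBound_atTop (hp : 2 ≤ p) (ha0 : 0 ≤ a) (ha : a < 1) :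
    Tendsto (normBound p a) atTop (𝓝 0) := by
  have hq := cast_sub_one_pos hp
  have hA : 0 < 1 - a ^ (p - 1) := sub_pos.2 (pow_lt_one₀ ha0 ha (by omega))
  have h1 : Tendsto (fun t => Real.exp (((p : ℝ) - 1) * t)) atTop atTop :=
    Real.tendsto_exp_atTop.comp (tendsto_id.const_mul_atTop hq)
  have h2 : Tendsto (boundBracket p a) atTop atTop := by
    have := tendsto_atTop_add_const_left atTop (a ^ (p - 1)) (h1.const_mul_atTop hA)
    refine this.congr fun t => ?_
    rw [boundBracket_eq]; ring
  exact ((tendsto_rpow_atTop (one_div_pos.2 hq)).comp h2).const_div_atTop a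

lemma normBound_one_left (p : ℕ) (t : ℝ) : normBound p 1 t = 1 := by
  simp [normBound, boundBracket]

lemma strictMonoOn_normBound (hp : 2 ≤ p) (ha : 1 < a) :
    StrictMonoOn (normBound p a) (Iio (finiteNormTime p a)) := fun _ _ _ ht hst =>
  normBound_lt_of_boundBracket_lt hp (zero_lt_one.trans ha) (boundBracket_pos_of_lt hp ha ht)
    (strictAnti_boundBracket hp ha hst)

lemma tendsto_normBound_finiteNormTime (hp : 2 ≤ p) (ha : 1 < a) :
    Tendsto (normBound p a) (𝓝[<] finiteNormTime p a) atTop := by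
  have hq := one_div_pos.2 (cast_sub_one_pos hp)
  have h1 : Tendsto (fun t => boundBracket p a t ^ (1 / ((p : ℝ) - 1))) (𝓝[<] finiteNormTime p a)
      (𝓝 0) := by
    have hc : Continuous fun t => boundBracket p a t ^ (1 / ((p : ℝ) - 1)) :=
      (continuous_boundBracket p a).rpow_const fun _ => Or.inr hq.le
    have := hc.tendsto (finiteNormTime p a)
    rw [boundBracket_finiteNormTime hp ha, Real.zero_rpow hq.ne'] at this
    exact this.mono_left nhdsWithin_le_nhds
  have h2 : Tendsto (fun t => boundBracket p a t ^ (1 / ((p : ℝ) - 1))) (𝓝[<] finiteNormTime p a)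
      (𝓝[>] 0) := by
    refine tendsto_nhdsWithin_iff.2 ⟨h1, ?_⟩
    filter_upwards [self_mem_nhdsWithin] with t ht
    exact Real.rpow_pos_of_pos (boundBracket_pos_of_lt hp ha ht) _
  exact (tendsto_inv_nhdsGT_zero.comp h2).const_mul_atTop (zero_lt_one.trans ha)

end Bound

/-! ### The nonlinear heat equation -/

lemma isDecayingFamily_heatSemigroup : IsDecayingFamily heatSemigroup where
  map_sub _ ht := heatSemigroup_sub ht
  norm_le _ ht := norm_heatSemigroup_le ht
  continuousOn := continuousOn_heatSemigroup

end DirichletHeat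

end

theorem proposition7p2 (p : ℕ) (hp : 2 ≤ p) (f₀ : DirichletHeat.H10) :
    -- the maximal solution `φ : [0, ϑ) → H¹₀(0, π)`, of which all solutions are restrictions
    (∃ (ϑ : EReal) (φ : ℝ → DirichletHeat.H10), 0 < ϑ ∧
      DirichletHeat.IsMaximalVolterraSolution DirichletHeat.heatSemigroup (DirichletHeat.power p) f₀
        {t : ℝ | 0 ≤ t ∧ (t : EReal) < ϑ} φ ∧
      (∀ (J : Set ℝ) (ψ : ℝ → DirichletHeat.H10),
        DirichletHeat.IsVolterraSolution DirichletHeat.heatSemigroup (DirichletHeat.power p) f₀ J ψ →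
        J ⊆ {t : ℝ | 0 ≤ t ∧ (t : EReal) < ϑ} ∧ Set.EqOn ψ φ J) ∧
      DirichletHeat.normTime p ‖f₀‖ ≤ ϑ ∧
      ∀ t : ℝ, 0 ≤ t → (t : EReal) < DirichletHeat.normTime p ‖f₀‖ →
        ‖φ t‖ ≤ DirichletHeat.normBound p ‖f₀‖ t) ∧
    -- the bound `R` is well defined on `[0, t_N)`
    (∀ t : ℝ, 0 ≤ t → (t : EReal) < DirichletHeat.normTime p ‖f₀‖ →
      0 < DirichletHeat.boundBracket p ‖f₀‖ t) ∧
    -- behaviour of `R`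
    (‖f₀‖ < 1 →
      AntitoneOn (DirichletHeat.normBound p ‖f₀‖) (Set.Ici 0) ∧
      (f₀ ≠ 0 → StrictAntiOn (DirichletHeat.normBound p ‖f₀‖) (Set.Ici 0)) ∧
      Filter.Tendsto (DirichletHeat.normBound p ‖f₀‖) Filter.atTop (nhds 0)) ∧
    (‖f₀‖ = 1 → ∀ t : ℝ, 0 ≤ t → DirichletHeat.normBound p ‖f₀‖ t = 1) ∧
    (1 < ‖f₀‖ →
      StrictMonoOn (DirichletHeat.normBound p ‖f₀‖)
        (Set.Ico 0 (DirichletHeat.finiteNormTime p ‖f₀‖)) ∧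
      Filter.Tendsto (DirichletHeat.normBound p ‖f₀‖)
        (nhdsWithin (DirichletHeat.finiteNormTime p ‖f₀‖)
          (Set.Iio (DirichletHeat.finiteNormTime p ‖f₀‖))) Filter.atTop) := by
  have hp0 : p ≠ 0 := by omega
  obtain ⟨ϑ, φ, hϑ, hmax, hres, hcmp⟩ := DirichletHeat.exists_maximal_volterra
    DirichletHeat.isDecayingFamily_heatSemigroup (DirichletHeat.norm_power_le p hp0)
    (fun M hM => DirichletHeat.exists_norm_power_sub_le p hp0 hM) f₀
  have hbracket : ∀ t : ℝ, 0 ≤ t → (t : EReal) < DirichletHeat.normTime p ‖f₀‖ →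
      0 < DirichletHeat.boundBracket p ‖f₀‖ t := fun t ht h =>
    DirichletHeat.boundBracket_pos hp (norm_nonneg f₀) ht h
  have hbelow : ∀ t : ℝ, 0 ≤ t → (t : EReal) < DirichletHeat.normTime p ‖f₀‖ →
      (t : EReal) < ϑ ∧ ‖φ t‖ ≤ DirichletHeat.normBound p ‖f₀‖ t := by
    intro t ht h
    have hpos : ∀ s ∈ Set.Icc 0 t, 0 < DirichletHeat.boundBracket p ‖f₀‖ s := fun s hs =>
      hbracket s hs.1 ((EReal.coe_le_coe_iff.2 hs.2).trans_lt h)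
    exact hcmp t (DirichletHeat.normBound p ‖f₀‖) ht (DirichletHeat.continuousOn_normBound hpos)
      (fun s hs => DirichletHeat.normBound_nonneg (norm_nonneg f₀) (hpos s hs))
      fun s hs => DirichletHeat.normBound_eq_integral hp hs.1 fun r hr =>
        hpos r ⟨hr.1, hr.2.trans hs.2⟩
  refine ⟨⟨ϑ, φ, hϑ, hmax, hres, ?_, fun t ht h => (hbelow t ht h).2⟩, hbracket, ?_, ?_, ?_⟩
  · refine EReal.ge_of_forall_gt_iff_ge.1 fun t ht => ?_
    rcases lt_or_ge t 0 with h0 | h0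
    · exact ((EReal.coe_lt_coe_iff.2 h0).trans hϑ).le
    · exact (hbelow t h0 ht).1.le
  · exact fun h => ⟨DirichletHeat.antitoneOn_normBound hp (norm_nonneg f₀) h,
      fun hf => DirichletHeat.strictAntiOn_normBound hp (norm_pos_iff.2 hf) h,
      DirichletHeat.tendsto_normBound_atTop hp (norm_nonneg f₀) h⟩
  · intro h t _
    rw [h, DirichletHeat.normBound_one_left]
  · exact fun h => ⟨(DirichletHeat.strictMonoOn_normBound hp h).mono fun _ ht => ht.2,
      DirichletHeat.tendsto_normBound_finiteNormTime hp h⟩
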